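/- **Theorem (High probability tracking error bound for SGDM).** There is a universal constant $C>0$ for which the following holds. *Problem.* Let $(\Omega,\mathcal F,(\mathcal F_t)_{t\ge 0},\mathbb P)$ be a filtered probability space, $(X_t)_{t\ge0}$ an adapted process in a measurable space $\mathcal X$, and $\Pi_{t+1}$ a regular conditional law of $X_{t+1}$ given $\mathcal F_t$. Let $g:\mathbb R^d\times\mathcal X\to\mathbb R$ be measurable and differentiable in its first argument, and put $$F_{t+1}(\theta)=\mathbb E[g(\theta,X_{t+1})\mid\mathcal F_t]=\int g(\theta,x)\,\Pi_{t+1}(dx),\qquad m_{t+1}(\theta)=\mathbb E[\nabla_\theta g(\theta,X_{t+1})\mid\mathcal F_t]=\int \nabla_\theta g(\theta,x)\,\Pi_{t+1}(dx),$$ where, almost surely, these integrals exist for all $\theta$, $F_{t+1}$ is twice differentiable on $\mathbb R^d$, and $\nabla F_{t+1}=m_{t+1}$. Let $\theta_{t+1}^\star$ be an $\mathcal F_t$-measurable random vector that almost surely minimizes $F_{t+1}$ $(t\ge0)$, and let $\theta_0^\star$ be any $\mathcal F_0$-measurable vector. Assume there are constants $\mu,L>0$ such that for all $t\ge0$, almost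 surely, for all $\theta,\theta'\in\mathbb R^d$, $$\langle m_{t+1}(\theta)-m_{t+1}(\theta'),\theta-\theta'\rangle\ge\mu\|\theta-\theta'\|^2,\qquad \|m_{t+1}(\theta)-m_{t+1}(\theta')\|\le L\|\theta-\theta'\|.$$ *Algorithm.* Let $\beta\in[0,1)$ and $\beta_1,\beta_2\ge 0$ with $\beta_1+\beta_2=\beta$ and $\beta_1\beta_2=0$, let $0<\gamma\le\min\{1/L,\ \mu(1-\beta)^2/(4L^2)\}$, and let $\theta_0$ be $\mathcal F_0$-measurable. With zero initial momentum $\theta_{-1}=\psi_{-1}=\theta_0$, let for $t\ge0$ $$\psi_t=\theta_t+\beta_1(\theta_t-\theta_{t-1}),\qquad \theta_{t+1}=\psi_t-\gamma\nabla_\theta g(\psi_t,X_{t+1})+\beta_2(\psi_t-\psi_{t-1}).$$ *Noise.* Let $\xi_{t+1}(\theta)=\nabla_\theta g(\theta,X_{t+1})-m_{t+1}(\theta)$ and assume that there is $\sigma>0$ such that for all $t\ge0$ and every unit vector $u\in\mathbb R^d$, $\mathbb E\big[\exp(\langle u,\xi_{t+1}(\psi_t)\rangle^2/\sigma^2)\mid\mathcal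 F_t\big]\le2$ almost surely, that is, $\|\xi_{t+1}(\psi_t)\mid\mathcal F_t\|_{\Psi_2}\le\sigma$. *Drift.* Let $\Delta_t=\theta_t^\star-\theta_{t+1}^\star$ for $t\ge0$ and $\Delta_{-1}=0$. For $\ell\ge0$ let $$H_\ell=\int_0^1\nabla^2F_{\ell+1}\big(\theta_{\ell+1}^\star+s(\psi_\ell-\theta_{\ell+1}^\star)\big)\,ds,\qquad K_\ell=-\beta I_d+\gamma\beta_1H_\ell,\qquad b_\ell=-(I_d-\gamma H_\ell)\Delta_\ell-K_\ell\Delta_{\ell-1},$$ and, with $\tilde\rho=1-\dfrac{\gamma^2\mu^2}{4(1-\beta)^2}$, $$\mathfrak D_T^{\mathrm{mom}}=\sum_{\ell=0}^{T-1}\tilde\rho^{\,T-\ell-1}\|b_\ell\|^2,\qquad \mathfrak D_T^{\mathrm{mom},(2)}=\sum_{\ell=0}^{T-1}\tilde\rho^{\,2(T-\ell-1)}\|b_\ell\|^2 .$$ *Conclusion.* For every $T\ge1$ and $\delta\in(0,1)$, with probability at least $1-\delta$, $$\begin{aligned}\|\theta_T-\theta_T^\star\|^2\le C\Big[&\frac{2}{(1-\beta)^2}\exp\!\Big(-\frac{\gamma^2\mu^2}{4(1-\beta)^2}T\Big)\|\theta_0-\theta_0^\star\|^2+\frac{d\sigma^2}{\mu^2}+\frac{1}{\gamma\mu(1-\beta)}\mathfrak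 D_T^{\mathrm{mom}}\\&+\Big(\frac{d\sigma^2\gamma^2}{(1-\beta)^2}+\frac{d^2\sigma^4\gamma^3}{\mu(1-\beta)^3}\Big)\log\frac{2T}{\delta}+\Big(\frac{\sigma^2}{\mu^2}+\frac{\sigma^2\gamma^2}{(1-\beta)^2}\mathfrak D_T^{\mathrm{mom},(2)}\Big)\log\frac{2T}{\delta}\Big].\end{aligned}$$ -/

import Mathlib

open MeasureTheory ProbabilityTheory

universe u v

noncomputable section

namespace SGDM

/-- The parameter space `ℝ^d` with its Euclidean norm. -/
abbrev Vec (d : ℕ) : Type := EuclideanSpace ℝ (Fin d)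

/-! ### The algorithm -/

/-- Stochastic gradient method with momentum and constant step size `γ`, run on the data path `x`.
The state at time `t` is `(θ_t, θ_{t-1}, ψ_{t-1})`. The initial state encodes the zero momentum
initialization `θ_{-1} = ψ_{-1} = θ_0`. One step is
`ψ_t = θ_t + β₁ (θ_t - θ_{t-1})`,
`θ_{t+1} = ψ_t - γ ∇g(ψ_t, x_{t+1}) + β₂ (ψ_t - ψ_{t-1})`. -/
def state {d : ℕ} {𝒳 : Type*} (g : Vec d → 𝒳 → ℝ) (γ β₁ β₂ : ℝ) (θ₀ : Vec d) (x : ℕ → 𝒳) :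
    ℕ → Vec d × Vec d × Vec d
  | 0 => (θ₀, θ₀, θ₀)
  | t + 1 =>
    let s := state g γ β₁ β₂ θ₀ x t
    let ψ := s.1 + β₁ • (s.1 - s.2.1)
    (ψ - γ • gradient (fun θ => g θ (x (t + 1))) ψ + β₂ • (ψ - s.2.2), s.1, ψ)

/-- The iterate `θ_t`. -/
def theta {d : ℕ} {𝒳 : Type*} (g : Vec d → 𝒳 → ℝ) (γ β₁ β₂ : ℝ) (θ₀ : Vec d) (x : ℕ → 𝒳)
    (t : ℕ) : Vec d :=
  (state g γ β₁ β₂ θ₀ x t).1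

/-- The look-ahead point `ψ_t = θ_t + β₁ (θ_t - θ_{t-1})`. -/
def psi {d : ℕ} {𝒳 : Type*} (g : Vec d → 𝒳 → ℝ) (γ β₁ β₂ : ℝ) (θ₀ : Vec d) (x : ℕ → 𝒳)
    (t : ℕ) : Vec d :=
  (state g γ β₁ β₂ θ₀ x t).1 +
    β₁ • ((state g γ β₁ β₂ θ₀ x t).1 - (state g γ β₁ β₂ θ₀ x t).2.1)

theorem psi_zero {d : ℕ} {𝒳 : Type*} (g : Vec d → 𝒳 → ℝ) (γ β₁ β₂ : ℝ) (θ₀ : Vec d)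
    (x : ℕ → 𝒳) : psi g γ β₁ β₂ θ₀ x 0 = θ₀ := by
  simp [psi, state]

theorem psi_succ {d : ℕ} {𝒳 : Type*} (g : Vec d → 𝒳 → ℝ) (γ β₁ β₂ : ℝ) (θ₀ : Vec d)
    (x : ℕ → 𝒳) (t : ℕ) :
    psi g γ β₁ β₂ θ₀ x (t + 1) = theta g γ β₁ β₂ θ₀ x (t + 1) +
      β₁ • (theta g γ β₁ β₂ θ₀ x (t + 1) - theta g γ β₁ β₂ θ₀ x t) := rfl

theorem theta_one {d : ℕ} {𝒳 : Type*} (g : Vec d → 𝒳 → ℝ) (γ β₁ β₂ : ℝ) (θ₀ : Vec d)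
    (x : ℕ → 𝒳) :
    theta g γ β₁ β₂ θ₀ x 1 = θ₀ - γ • gradient (fun θ => g θ (x 1)) θ₀ := by
  simp [theta, state]

theorem theta_succ_succ {d : ℕ} {𝒳 : Type*} (g : Vec d → 𝒳 → ℝ) (γ β₁ β₂ : ℝ) (θ₀ : Vec d)
    (x : ℕ → 𝒳) (t : ℕ) :
    theta g γ β₁ β₂ θ₀ x (t + 2) = psi g γ β₁ β₂ θ₀ x (t + 1)
      - γ • gradient (fun θ => g θ (x (t + 2))) (psi g γ β₁ β₂ θ₀ x (t + 1))
      + β₂ • (psi g γ β₁ β₂ θ₀ x (t + 1) - psi g γ β₁ β₂ θ₀ x t) := rfl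

/-! ### The nonstationary stochastic problem -/

/-- `κ` is a regular conditional law of `Y` given the sub-σ-algebra `m`. -/
structure IsRegCondLaw {Ω 𝒳 : Type*} [MeasurableSpace 𝒳] (m : MeasurableSpace Ω)
    [MeasurableSpace Ω] (P : Measure Ω) (Y : Ω → 𝒳) (κ : Ω → Measure 𝒳) : Prop where
  measurable : Measurable[m] κ
  isProbabilityMeasure : ∀ ω, IsProbabilityMeasure (κ ω)
  condProb_eq : ∀ A : Set 𝒳, MeasurableSet A →
    (fun ω => (κ ω).real A) =ᵐ[P] P[(Y ⁻¹' A).indicator (fun _ => (1 : ℝ)) | m]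

/-- The risk `θ ↦ 𝔼_{X ∼ ν} g(θ, X)`. With `ν = Π_{t+1}(ω)`, the regular conditional law of
`X_{t+1}` given `ℱ_t`, this is the conditional risk `𝔼[g(θ, X_{t+1}) | ℱ_t](ω)`. -/
def risk {d : ℕ} {𝒳 : Type*} [MeasurableSpace 𝒳] (g : Vec d → 𝒳 → ℝ) (ν : Measure 𝒳)
    (θ : Vec d) : ℝ :=
  ∫ x, g θ x ∂ν

/-- The mean gradient `θ ↦ 𝔼_{X ∼ ν} ∇g(θ, X)`. With `ν = Π_{t+1}(ω)` this is the conditional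
mean gradient `m_{t+1}(θ)(ω)`. -/
def meanGrad {d : ℕ} {𝒳 : Type*} [MeasurableSpace 𝒳] (g : Vec d → 𝒳 → ℝ) (ν : Measure 𝒳)
    (θ : Vec d) : Vec d :=
  ∫ x, gradient (fun θ' => g θ' x) θ ∂ν

/-- The predictable tracking problem. `law (t + 1)` is the regular conditional law `Π_{t+1}` of
`X_{t+1}` given `ℱ_t` (the value `law 0` is not used), and `θs (t + 1)` is an `ℱ_t`-measurable
minimizer of the conditional risk. The reference point `θs 0` is any `ℱ_0`-measurable vector.
The conditional risk is twice differentiable and its gradient is the conditional mean gradient. -/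
structure IsTrackingProblem {d : ℕ} {Ω 𝒳 : Type*} [MeasurableSpace 𝒳] [mΩ : MeasurableSpace Ω]
    (P : Measure Ω) (ℱ : Filtration ℕ mΩ) (X : ℕ → Ω → 𝒳) (law : ℕ → Ω → Measure 𝒳)
    (g : Vec d → 𝒳 → ℝ) (θs : ℕ → Ω → Vec d) : Prop where
  adapted : ∀ t, Measurable[ℱ t] (X t)
  condLaw : ∀ t, IsRegCondLaw (ℱ t) P (X (t + 1)) (law (t + 1))
  measurable_loss : Measurable (Function.uncurry g)
  differentiable_loss : ∀ x, Differentiable ℝ (fun θ => g θ x)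
  integrable_loss : ∀ t, ∀ᵐ ω ∂P, ∀ θ, Integrable (fun x => g θ x) (law (t + 1) ω)
  integrable_grad : ∀ t, ∀ᵐ ω ∂P, ∀ θ,
    Integrable (fun x => gradient (fun θ' => g θ' x) θ) (law (t + 1) ω)
  hasGradientAt_risk : ∀ t, ∀ᵐ ω ∂P, ∀ θ,
    HasGradientAt (risk g (law (t + 1) ω)) (meanGrad g (law (t + 1) ω) θ) θ
  twice_differentiable_risk : ∀ t, ∀ᵐ ω ∂P, Differentiable ℝ (gradient (risk g (law (t + 1) ω)))
  measurable_star_zero : Measurable[ℱ 0] (θs 0)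
  predictable_star : ∀ t, Measurable[ℱ t] (θs (t + 1))
  isMinOn_star : ∀ t, ∀ᵐ ω ∂P, IsMinOn (risk g (law (t + 1) ω)) Set.univ (θs (t + 1) ω)

/-- Uniform `μ`-strong monotonicity of the conditional mean gradients. -/
def UniformlyStronglyMonotone {d : ℕ} {Ω 𝒳 : Type*} [MeasurableSpace 𝒳] [MeasurableSpace Ω]
    (P : Measure Ω) (law : ℕ → Ω → Measure 𝒳) (g : Vec d → 𝒳 → ℝ) (μ : ℝ) : Prop :=
  ∀ t, ∀ᵐ ω ∂P, ∀ θ θ' : Vec d,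
    μ * ‖θ - θ'‖ ^ 2 ≤
      inner ℝ (meanGrad g (law (t + 1) ω) θ - meanGrad g (law (t + 1) ω) θ') (θ - θ')

/-- Uniform `L`-Lipschitz continuity of the conditional mean gradients. -/
def UniformlyLipschitz {d : ℕ} {Ω 𝒳 : Type*} [MeasurableSpace 𝒳] [MeasurableSpace Ω]
    (P : Measure Ω) (law : ℕ → Ω → Measure 𝒳) (g : Vec d → 𝒳 → ℝ) (L : ℝ) : Prop :=
  ∀ t, ∀ᵐ ω ∂P, ∀ θ θ' : Vec d,
    ‖meanGrad g (law (t + 1) ω) θ - meanGrad g (law (t + 1) ω) θ'‖ ≤ L * ‖θ - θ'‖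

/-- The gradient noise `ξ(θ) = ∇g(θ, x) - m(θ)`, where `m` is the mean gradient under `ν`. -/
def noise {d : ℕ} {𝒳 : Type*} [MeasurableSpace 𝒳] (g : Vec d → 𝒳 → ℝ) (ν : Measure 𝒳)
    (x : 𝒳) (θ : Vec d) : Vec d :=
  gradient (fun θ' => g θ' x) θ - meanGrad g ν θ

/-- The conditional Orlicz norm bound `‖Z | m‖_{Ψ₂} ≤ σ` for a random vector `Z`: for each unit
vector `u`, `𝔼[exp((|⟨u, Z⟩| / σ)²) | m] ≤ 2` almost surely. Integrability is part of the
definition because the conditional expectation of a non-integrable function is `0` in Mathlib. -/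
def CondSubGaussian {d : ℕ} {Ω : Type*} (m : MeasurableSpace Ω) [MeasurableSpace Ω]
    (P : Measure Ω) (Z : Ω → Vec d) (σ : ℝ) : Prop :=
  ∀ u : Vec d, ‖u‖ = 1 →
    Integrable (fun ω => Real.exp ((|inner ℝ u (Z ω)| / σ) ^ 2)) P ∧
    ∀ᵐ ω ∂P, (P[fun ω' => Real.exp ((|inner ℝ u (Z ω')| / σ) ^ 2) | m]) ω ≤ 2

/-! ### The drift forcing terms -/

/-- The averaged Hessian `∫₀¹ ∇²F(θ⋆ + s (ψ - θ⋆)) ds` of the risk `F` under `ν`. -/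
def avgHessian {d : ℕ} {𝒳 : Type*} [MeasurableSpace 𝒳] (g : Vec d → 𝒳 → ℝ) (ν : Measure 𝒳)
    (θstar ψ : Vec d) : Vec d →L[ℝ] Vec d :=
  ∫ s in (0 : ℝ)..1, fderiv ℝ (gradient (risk g ν)) (θstar + s • (ψ - θstar))

/-- The minimizer drift `Δ_t = θ⋆_t - θ⋆_{t+1}` along a path of minimizers. -/
def drift {d : ℕ} (θs : ℕ → Vec d) (t : ℕ) : Vec d := θs t - θs (t + 1)

/-- The previous drift `Δ_{t-1}`, with `Δ_{-1} = 0`. -/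
def prevDrift {d : ℕ} (θs : ℕ → Vec d) : ℕ → Vec d
  | 0 => 0
  | t + 1 => drift θs t

/-- The drift forcing term `b_t = -(I - γ H_t) Δ_t - K_t Δ_{t-1}`, where
`K_t = -β I + γ β₁ H_t` and `β = β₁ + β₂`. -/
def forcing {d : ℕ} (γ β₁ β₂ : ℝ) (H : ℕ → Vec d →L[ℝ] Vec d) (θs : ℕ → Vec d) (t : ℕ) : Vec d :=
  -(ContinuousLinearMap.id ℝ (Vec d) - γ • H t) (drift θs t)
    - (-((β₁ + β₂) • ContinuousLinearMap.id ℝ (Vec d)) + (γ * β₁) • H t) (prevDrift θs t)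

/-- The random drift forcing term `b_t` of the method run on the path `X`, with the averaged Hessians
`H_t = ∫₀¹ ∇²F_{t+1}(θ⋆_{t+1} + s (ψ_t - θ⋆_{t+1})) ds` of the conditional risks `F_{t+1}`. -/
def randomForcing {d : ℕ} {Ω 𝒳 : Type*} [MeasurableSpace 𝒳] (g : Vec d → 𝒳 → ℝ)
    (γ β₁ β₂ : ℝ) (law : ℕ → Ω → Measure 𝒳) (θs : ℕ → Ω → Vec d) (θ₀ : Ω → Vec d)
    (X : ℕ → Ω → 𝒳) (ω : Ω) (t : ℕ) : Vec d :=
  forcing γ β₁ β₂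
    (fun n => avgHessian g (law (n + 1) ω) (θs (n + 1) ω)
      (psi g γ β₁ β₂ (θ₀ ω) (fun k => X k ω) n))
    (fun n => θs n ω) t

/-- The discount factor `1 - γ² μ² / (4 (1 - β)²)`. -/
def discount (γ μ β : ℝ) : ℝ := 1 - γ ^ 2 * μ ^ 2 / (4 * (1 - β) ^ 2)

/-- The discounted drift sum `∑_{ℓ < T} ρ^{T-ℓ-1} ‖b_ℓ‖²`. -/
def driftSum {d : ℕ} (ρ : ℝ) (b : ℕ → Vec d) (T : ℕ) : ℝ :=
  ∑ l ∈ Finset.range T, ρ ^ (T - l - 1) * ‖b l‖ ^ 2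

/-- The discounted drift sum `∑_{ℓ < T} ρ^{2(T-ℓ-1)} ‖b_ℓ‖²`. -/
def driftSum₂ {d : ℕ} (ρ : ℝ) (b : ℕ → Vec d) (T : ℕ) : ℝ :=
  ∑ l ∈ Finset.range T, ρ ^ (2 * (T - l - 1)) * ‖b l‖ ^ 2

/-- The bound on the squared tracking error, up to a constant factor. Here `D` and `D₂` are the
two discounted drift sums and `e₀` is the norm of the initial tracking error. -/
def trackingBound (d T : ℕ) (γ β μ σ δ e₀ D D₂ : ℝ) : ℝ :=
  2 / (1 - β) ^ 2 * Real.exp (-(γ ^ 2 * μ ^ 2 / (4 * (1 - β) ^ 2)) * T) * e₀ ^ 2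
    + d * σ ^ 2 / μ ^ 2
    + 1 / (γ * μ) * (1 / (1 - β)) * D
    + (d * σ ^ 2 * γ ^ 2 / (1 - β) ^ 2 + (d : ℝ) ^ 2 * σ ^ 4 * γ ^ 3 / (μ * (1 - β) ^ 3))
        * Real.log (2 * T / δ)
    + (σ ^ 2 / μ ^ 2 + σ ^ 2 * γ ^ 2 / (1 - β) ^ 2 * D₂) * Real.log (2 * T / δ)

end SGDM

end

/-! ### Exponential moments of sub-Gaussian vectors -/

namespace SGDM

/-! Put `k = 1 - β`, `q = γ μ / k`, `e_t = θ_t - θ⋆_t`, `w_t = e_t - e_{t-1}` and `y_t = e_t + ((1 -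
k) / k) w_t`. Because `β₁ β₂ = 0`, heavy ball and Nesterov momentum give the same recursion up to
the point at which the averaged Hessian `H` acts. In these coordinates it decouples: with `h = H (e
+ β₁ w)`, the step without noise sends `y` to `y - (γ / k) h - b / k` and `w` to `(1 - k) w - γ h -
b`. So `y` performs gradient descent with the effective step `γ / k`, `w` is damped by `1 - k`, and
the noise enters `y` and `w / k` with the same coefficient `-γ / k`.

The Lyapunov function `V = ‖y‖² + ‖w / k‖²` contracts by `1 - q / 4` up to `9 ‖b‖² / (γ μ k)`
(`lyapunov_step`). Directional sub-Gaussianity bounds the conditional exponential moment of `l V`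
after the noise at the price of a factor `1 + q / 8` and an additive `2 d (γ / k)² σ²`, for `l`
small enough (`SubGaussianUnder.lintegral_exp_lyapunov_le`).

The forcing is random, so it is carried inside a predictable budget `B_{t+1} = (1 - q / 8) B_t + 2
D_t + c` with `B_0 = V_0`, where `D_t` is the excess of the predictable state over its contraction.
One step gives `𝔼 exp (l (V_{t+1} - B_{t+1})) ≤ 𝔼 exp (l (1 - q / 8) (V_t - B_t))`, and Jensen's
inequality bounds the right side by a power of `𝔼 exp (l (V_t - B_t))`. Hence this moment never
exceeds `1` (`IsTrackingProblem.lintegral_exp_lyapunov_sub_budget_le_one`), with no moment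
assumption on the initial error or the drift.

Markov's inequality at the single time `T` gives `V_T < B_T + log (1 / δ) / l` outside an event of
probability `δ`. Unrolling `B_T`, bounding `D_t` by the forcing and choosing `l` as large as allowed
gives the claim. No union bound over time is taken: `log (2 T / δ)` and the terms with `d² σ⁴` and
the second drift sum are slack. -/

theorem lintegral_rpow_le_rpow_lintegral {α : Type*} [MeasurableSpace α] (ν : Measure α)
    [IsProbabilityMeasure ν] {F : α → ENNReal} (hF : AEMeasurable F ν) {s : ℝ} (h0 : 0 ≤ s)
    (h1 : s ≤ 1) : ∫⁻ x, F x ^ s ∂ν ≤ (∫⁻ x, F x ∂ν) ^ s := by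
  rcases h0.eq_or_lt with rfl | h0
  · simp
  rcases h1.eq_or_lt with rfl | h1
  · simp
  have hpq : (1 / s).HolderConjugate (1 / (1 - s)) := by
    rw [Real.holderConjugate_iff]
    refine ⟨by rw [lt_div_iff₀ h0]; linarith, by simp⟩
  have h := ENNReal.lintegral_mul_le_Lp_mul_Lq ν hpq (hF.pow_const s)
    (aemeasurable_const (b := (1 : ENNReal)))
  simpa [← ENNReal.rpow_mul, mul_inv_cancel₀ h0.ne'] using h

/-- Jensen's inequality gives `2 ^ s`, and `2 ≤ e`. The resulting bound is `1` at `s = 0`, so small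
exponents cost little. -/
theorem lintegral_exp_mul_le {α : Type*} [MeasurableSpace α] (ν : Measure α)
    [IsProbabilityMeasure ν] {f : α → ℝ} (hf : Measurable f)
    (h2 : ∫⁻ x, ENNReal.ofReal (Real.exp (f x)) ∂ν ≤ 2) {s : ℝ} (h0 : 0 ≤ s) (h1 : s ≤ 1) :
    ∫⁻ x, ENNReal.ofReal (Real.exp (s * f x)) ∂ν ≤ ENNReal.ofReal (Real.exp s) := by
  have h := lintegral_rpow_le_rpow_lintegral ν (F := fun x => ENNReal.ofReal (Real.exp (f x)))
    (by fun_prop) h0 h1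
  have e : ∀ x, ENNReal.ofReal (Real.exp (f x)) ^ s = ENNReal.ofReal (Real.exp (s * f x)) := by
    intro x
    rw [ENNReal.ofReal_rpow_of_pos (Real.exp_pos _), ← Real.exp_mul, mul_comm]
  simp only [e] at h
  refine h.trans ((ENNReal.rpow_le_rpow h2 h0).trans ?_)
  have : (2 : ENNReal) ≤ ENNReal.ofReal (Real.exp 1) := by
    rw [← ENNReal.ofReal_ofNat]
    exact ENNReal.ofReal_le_ofReal (by linarith [Real.add_one_le_exp 1])
  refine (ENNReal.rpow_le_rpow this h0).trans ?_
  rw [ENNReal.ofReal_rpow_of_pos (Real.exp_pos _), ← Real.exp_mul, one_mul]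

/-- The linear term integrates to zero for centred variables, which leaves only the square that the
Orlicz bound controls. -/
theorem exp_le_add_exp_sq (x : ℝ) : Real.exp x ≤ x + Real.exp (x ^ 2) := by
  have h2 := Real.add_one_le_exp (x ^ 2)
  rcases le_total x (-1) with h | h
  · have : Real.exp x ≤ 1 := Real.exp_le_one_iff.2 (by linarith)
    nlinarith
  rcases le_total x 1 with h' | h'
  · have := Real.abs_exp_sub_one_sub_id_le (abs_le.2 ⟨h, h'⟩)
    linarith [(abs_le.1 this).2]
  · have : Real.exp x ≤ Real.exp (x ^ 2) := Real.exp_le_exp.2 (by nlinarith)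
    linarith

/-- The directional Orlicz bound `‖ζ‖_{Ψ₂} ≤ σ` under a fixed law `ν`. -/
def SubGaussianUnder {d : ℕ} {α : Type*} [MeasurableSpace α] (ν : Measure α) (ζ : α → Vec d)
    (σ : ℝ) : Prop :=
  ∀ u : Vec d, ‖u‖ = 1 →
    ∫⁻ x, ENNReal.ofReal (Real.exp ((|inner ℝ u (ζ x)| / σ) ^ 2)) ∂ν ≤ 2

variable {d : ℕ} {α : Type*} [MeasurableSpace α] {ν : Measure α} [IsProbabilityMeasure ν]
  {ζ : α → Vec d} {σ : ℝ}

/-- Two regimes. If `σ ‖a‖ ≤ 1`, centring removes the linear term of `exp_le_add_exp_sq`, and the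
square is the Orlicz exponent scaled by `σ² ‖a‖² ≤ 1`. Otherwise `2 x y ≤ x² + y²` splits the
exponent, and the leftover factor `exp (1 / 2)` is absorbed because `σ² ‖a‖² ≥ 1`. -/
theorem SubGaussianUnder.lintegral_exp_inner_le (hs : SubGaussianUnder ν ζ σ) (hσ : 0 < σ)
    (hm : Measurable ζ) (hi : Integrable ζ ν) (h0 : ∫ x, ζ x ∂ν = 0) (a : Vec d) :
    ∫⁻ x, ENNReal.ofReal (Real.exp (inner ℝ a (ζ x))) ∂ν
      ≤ ENNReal.ofReal (Real.exp (σ ^ 2 * ‖a‖ ^ 2)) := by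
  by_cases ha : a = 0
  · simp [ha]
  have hna : 0 < ‖a‖ := norm_pos_iff.2 ha
  set u : Vec d := (‖a‖⁻¹ : ℝ) • a with hu
  have hu1 : ‖u‖ = 1 := by
    rw [hu, norm_smul, norm_inv, norm_norm, inv_mul_cancel₀ hna.ne']
  have hau : ∀ x, inner ℝ a (ζ x) = ‖a‖ * inner ℝ u (ζ x) := by
    intro x
    rw [hu, real_inner_smul_left, ← mul_assoc, mul_inv_cancel₀ hna.ne', one_mul]
  have hmu : Measurable fun x => (|inner ℝ u (ζ x)| / σ) ^ 2 := by fun_prop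
  have hsq : ∀ x, (|inner ℝ u (ζ x)| / σ) ^ 2 = inner ℝ u (ζ x) ^ 2 / σ ^ 2 := by
    intro x; rw [div_pow, sq_abs]
  rcases le_total (σ ^ 2 * ‖a‖ ^ 2) 1 with hc | hc
  · have hle := lintegral_exp_mul_le ν hmu (hs u hu1) (s := σ ^ 2 * ‖a‖ ^ 2) (by positivity) hc
    have e : ∀ x, σ ^ 2 * ‖a‖ ^ 2 * (|inner ℝ u (ζ x)| / σ) ^ 2 = (inner ℝ a (ζ x)) ^ 2 := by
      intro x; rw [hsq, hau]; field_simp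
    simp only [e] at hle
    have hint2 : Integrable (fun x => Real.exp ((inner ℝ a (ζ x)) ^ 2)) ν := by
      refine (lintegral_ofReal_ne_top_iff_integrable (by fun_prop)
        (ae_of_all _ fun x => (Real.exp_pos _).le)).1 (ne_top_of_le_ne_top ENNReal.ofReal_ne_top hle)
    have hint1 : Integrable (fun x => inner ℝ a (ζ x)) ν := hi.const_inner a
    have hz : ∫ x, inner ℝ a (ζ x) ∂ν = 0 := by
      rw [integral_inner hi, h0, inner_zero_right]
    have hint3 : Integrable (fun x => Real.exp (inner ℝ a (ζ x))) ν := by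
      refine (hint1.add hint2).mono' (by fun_prop) (ae_of_all _ fun x => ?_)
      rw [Real.norm_eq_abs, abs_of_pos (Real.exp_pos _)]
      exact exp_le_add_exp_sq _
    rw [← ofReal_integral_eq_lintegral_ofReal hint3 (ae_of_all _ fun x => (Real.exp_pos _).le)]
    rw [← ofReal_integral_eq_lintegral_ofReal hint2 (ae_of_all _ fun x => (Real.exp_pos _).le)] at hle
    refine le_trans (ENNReal.ofReal_le_ofReal ?_) hle
    calc ∫ x, Real.exp (inner ℝ a (ζ x)) ∂ν
        ≤ ∫ x, (inner ℝ a (ζ x) + Real.exp ((inner ℝ a (ζ x)) ^ 2)) ∂ν :=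
          integral_mono hint3 (hint1.add hint2) fun x => exp_le_add_exp_sq _
      _ = ∫ x, Real.exp ((inner ℝ a (ζ x)) ^ 2) ∂ν := by
          rw [integral_add hint1 hint2, hz, zero_add]
  · have hle := lintegral_exp_mul_le ν hmu (hs u hu1) (s := 1 / 2) (by norm_num) (by norm_num)
    calc ∫⁻ x, ENNReal.ofReal (Real.exp (inner ℝ a (ζ x))) ∂ν
        ≤ ∫⁻ x, ENNReal.ofReal (Real.exp (σ ^ 2 * ‖a‖ ^ 2 / 2)) *
            ENNReal.ofReal (Real.exp (1 / 2 * (|inner ℝ u (ζ x)| / σ) ^ 2)) ∂ν := by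
          refine lintegral_mono fun x => ?_
          rw [← ENNReal.ofReal_mul (Real.exp_pos _).le, ← Real.exp_add]
          refine ENNReal.ofReal_le_ofReal (Real.exp_le_exp.2 ?_)
          rw [hau, ← sq_abs (|inner ℝ u (ζ x)| / σ), abs_div, abs_abs, abs_of_pos hσ]
          have h1 : inner ℝ u (ζ x) ≤ σ * (|inner ℝ u (ζ x)| / σ) := by
            rw [mul_div_cancel₀ _ hσ.ne']; exact le_abs_self _
          have := mul_le_mul_of_nonneg_left h1 hna.le
          nlinarith [sq_nonneg (σ * ‖a‖ - |inner ℝ u (ζ x)| / σ)]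
      _ = ENNReal.ofReal (Real.exp (σ ^ 2 * ‖a‖ ^ 2 / 2)) *
            ∫⁻ x, ENNReal.ofReal (Real.exp (1 / 2 * (|inner ℝ u (ζ x)| / σ) ^ 2)) ∂ν :=
          lintegral_const_mul _ (by fun_prop)
      _ ≤ ENNReal.ofReal (Real.exp (σ ^ 2 * ‖a‖ ^ 2 / 2)) * ENNReal.ofReal (Real.exp (1 / 2)) := by
          gcongr
      _ ≤ ENNReal.ofReal (Real.exp (σ ^ 2 * ‖a‖ ^ 2)) := by
          rw [← ENNReal.ofReal_mul (Real.exp_pos _).le, ← Real.exp_add]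
          exact ENNReal.ofReal_le_ofReal (Real.exp_le_exp.2 (by linarith))

/-- The coordinates may be dependent, so `exp` of their sum is averaged by convexity with weights `1
/ d`. Each coordinate then carries the Orlicz exponent scaled by `d η σ²`, which must be at most
`1`. -/
theorem SubGaussianUnder.lintegral_exp_norm_sq_le (hs : SubGaussianUnder ν ζ σ) (hσ : 0 < σ)
    (hm : Measurable ζ) (hd : 0 < d) {η : ℝ} (hη : 0 ≤ η) (h1 : d * η * σ ^ 2 ≤ 1) :
    ∫⁻ x, ENNReal.ofReal (Real.exp (η * ‖ζ x‖ ^ 2)) ∂ν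
      ≤ ENNReal.ofReal (Real.exp (d * η * σ ^ 2)) := by
  have hd' : (0 : ℝ) < d := by exact_mod_cast hd
  have hnorm : ∀ i : Fin d, ‖EuclideanSpace.single i (1 : ℝ)‖ = 1 := by simp
  have hcoord : ∀ (i : Fin d) (z : Vec d), inner ℝ (EuclideanSpace.single i (1 : ℝ)) z = z i := by
    intro i z; simp [EuclideanSpace.inner_single_left]
  have hi : ∀ i : Fin d,
      ∫⁻ x, ENNReal.ofReal (Real.exp (d * η * σ ^ 2 * (|ζ x i| / σ) ^ 2)) ∂ν
        ≤ ENNReal.ofReal (Real.exp (d * η * σ ^ 2)) := by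
    intro i
    refine lintegral_exp_mul_le ν (by fun_prop) ?_ (by positivity) h1
    simpa only [hcoord] using hs _ (hnorm i)
  calc ∫⁻ x, ENNReal.ofReal (Real.exp (η * ‖ζ x‖ ^ 2)) ∂ν
      ≤ ∫⁻ x, ∑ i : Fin d, ENNReal.ofReal (d : ℝ)⁻¹ *
          ENNReal.ofReal (Real.exp (d * η * σ ^ 2 * (|ζ x i| / σ) ^ 2)) ∂ν := by
        refine lintegral_mono fun x => ?_
        have hj := convexOn_exp.map_sum_le (t := Finset.univ) (w := fun _ : Fin d => (d : ℝ)⁻¹)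
          (p := fun i => d * η * σ ^ 2 * (|ζ x i| / σ) ^ 2) (fun _ _ => by positivity)
          (by simp [hd'.ne']) (fun _ _ => Set.mem_univ _)
        have e : ∑ i : Fin d, (d : ℝ)⁻¹ • (d * η * σ ^ 2 * (|ζ x i| / σ) ^ 2)
            = η * ‖ζ x‖ ^ 2 := by
          rw [EuclideanSpace.real_norm_sq_eq, Finset.mul_sum]
          refine Finset.sum_congr rfl fun i _ => ?_
          rw [div_pow, sq_abs, smul_eq_mul]; field_simp
        rw [e] at hj
        refine (ENNReal.ofReal_le_ofReal hj).trans ?_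
        rw [ENNReal.ofReal_sum_of_nonneg (fun i _ => by positivity)]
        refine Finset.sum_le_sum fun i _ => ?_
        rw [smul_eq_mul, ENNReal.ofReal_mul (by positivity)]
    _ = ∑ i : Fin d, ENNReal.ofReal (d : ℝ)⁻¹ *
          ∫⁻ x, ENNReal.ofReal (Real.exp (d * η * σ ^ 2 * (|ζ x i| / σ) ^ 2)) ∂ν := by
        rw [lintegral_finsetSum _ (fun i _ => by fun_prop)]
        exact Finset.sum_congr rfl fun i _ => lintegral_const_mul _ (by fun_prop)
    _ ≤ ∑ i : Fin d, ENNReal.ofReal (d : ℝ)⁻¹ * ENNReal.ofReal (Real.exp (d * η * σ ^ 2)) := by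
        gcongr with i
        exact hi i
    _ = ENNReal.ofReal (Real.exp (d * η * σ ^ 2)) := by
        rw [Finset.sum_const, Finset.card_univ, Fintype.card_fin, nsmul_eq_mul, ← mul_assoc,
          ENNReal.ofReal_inv_of_pos hd', ENNReal.ofReal_natCast,
          ENNReal.mul_inv_cancel (by exact_mod_cast hd.ne') (ENNReal.natCast_ne_top d), one_mul]

/-- Cauchy–Schwarz separates the linear and quadratic parts; it doubles both exponents, whence the
factors `2`. -/
theorem SubGaussianUnder.lintegral_exp_inner_add_norm_sq_le (hs : SubGaussianUnder ν ζ σ)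
    (hσ : 0 < σ) (hm : Measurable ζ) (hi : Integrable ζ ν) (h0 : ∫ x, ζ x ∂ν = 0) (hd : 0 < d)
    (a : Vec d) {η : ℝ} (hη : 0 ≤ η) (h1 : 2 * d * η * σ ^ 2 ≤ 1) :
    ∫⁻ x, ENNReal.ofReal (Real.exp (inner ℝ a (ζ x) + η * ‖ζ x‖ ^ 2)) ∂ν
      ≤ ENNReal.ofReal (Real.exp (2 * σ ^ 2 * ‖a‖ ^ 2 + d * η * σ ^ 2)) := by
  have hA := hs.lintegral_exp_inner_le hσ hm hi h0 ((2 : ℝ) • a)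
  have hB := hs.lintegral_exp_norm_sq_le hσ hm hd (η := 2 * η) (by positivity) (by linarith)
  have h := ENNReal.lintegral_mul_le_Lp_mul_Lq ν Real.HolderConjugate.two_two
    (f := fun x => ENNReal.ofReal (Real.exp (inner ℝ a (ζ x))))
    (g := fun x => ENNReal.ofReal (Real.exp (η * ‖ζ x‖ ^ 2))) (by fun_prop) (by fun_prop)
  have e1 : ∀ x, ENNReal.ofReal (Real.exp (inner ℝ a (ζ x))) ^ (2 : ℝ)
      = ENNReal.ofReal (Real.exp (inner ℝ ((2 : ℝ) • a) (ζ x))) := by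
    intro x
    rw [ENNReal.ofReal_rpow_of_pos (Real.exp_pos _), ← Real.exp_mul, real_inner_smul_left, mul_comm]
  have e2 : ∀ x, ENNReal.ofReal (Real.exp (η * ‖ζ x‖ ^ 2)) ^ (2 : ℝ)
      = ENNReal.ofReal (Real.exp (2 * η * ‖ζ x‖ ^ 2)) := by
    intro x
    rw [ENNReal.ofReal_rpow_of_pos (Real.exp_pos _), ← Real.exp_mul]; ring_nf
  simp only [e1, e2, Pi.mul_apply] at h
  calc ∫⁻ x, ENNReal.ofReal (Real.exp (inner ℝ a (ζ x) + η * ‖ζ x‖ ^ 2)) ∂ν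
      = ∫⁻ x, ENNReal.ofReal (Real.exp (inner ℝ a (ζ x))) *
          ENNReal.ofReal (Real.exp (η * ‖ζ x‖ ^ 2)) ∂ν := by
        refine lintegral_congr fun x => ?_
        rw [Real.exp_add, ENNReal.ofReal_mul (Real.exp_pos _).le]
    _ ≤ _ := h
    _ ≤ ENNReal.ofReal (Real.exp (σ ^ 2 * ‖(2 : ℝ) • a‖ ^ 2)) ^ (1 / 2 : ℝ) *
          ENNReal.ofReal (Real.exp (d * (2 * η) * σ ^ 2)) ^ (1 / 2 : ℝ) := by
        gcongr
    _ = ENNReal.ofReal (Real.exp (2 * σ ^ 2 * ‖a‖ ^ 2 + d * η * σ ^ 2)) := by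
        rw [ENNReal.ofReal_rpow_of_pos (Real.exp_pos _), ENNReal.ofReal_rpow_of_pos (Real.exp_pos _),
          ← Real.exp_mul, ← Real.exp_mul, ← ENNReal.ofReal_mul (Real.exp_pos _).le, ← Real.exp_add,
          norm_smul, Real.norm_ofNat]
        ring_nf

end SGDM

/-! ### The Lyapunov function of the momentum recursion -/

namespace SGDM

theorem norm_sub_sq_le_young {E : Type*} [NormedAddCommGroup E] (u v : E) {ε : ℝ} (hε : 0 < ε) :
    ‖u - v‖ ^ 2 ≤ (1 + ε) * ‖u‖ ^ 2 + (1 + 1 / ε) * ‖v‖ ^ 2 := by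
  have h1 : ‖u - v‖ ≤ ‖u‖ + ‖v‖ := norm_sub_le u v
  have h2 : ‖u - v‖ ^ 2 ≤ (‖u‖ + ‖v‖) ^ 2 := pow_le_pow_left₀ (norm_nonneg _) h1 2
  have h3 : 2 * ‖u‖ * ‖v‖ ≤ ε * ‖u‖ ^ 2 + 1 / ε * ‖v‖ ^ 2 := by
    have e : ε * ‖u‖ ^ 2 + 1 / ε * ‖v‖ ^ 2 - 2 * ‖u‖ * ‖v‖ = (ε * ‖u‖ - ‖v‖) ^ 2 / ε := by
      field_simp; ring
    have : 0 ≤ (ε * ‖u‖ - ‖v‖) ^ 2 / ε := by positivity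
    linarith
  nlinarith

/-! ### Deterministic contraction of the noiseless step -/

section Lyapunov

variable {E : Type*} [NormedAddCommGroup E] [InnerProductSpace ℝ E]

/-- Price of evaluating the gradient at `p = y - c w` instead of `y`. The first term on the right
uses part of the gain from strong monotonicity, the second is half of the dissipation `W² / k` of
the momentum component. -/
theorem lyapunov_cross_term_le {μ L γ k c : ℝ} (hμ : 0 < μ) (hk : 0 < k) (hc : 0 ≤ c)
    (hck : c * k ≤ 1 - k) (hγ : 0 < γ) (hγL : 4 * (γ * L ^ 2) ≤ μ * k ^ 2) (P W : ℝ) :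
    2 * (γ / k) * (c * (W * (L * P))) ≤ γ / k * μ * P ^ 2 / 2 + W ^ 2 / (2 * k) := by
  have hg : 0 < γ / k := by positivity
  have h1 : 2 * (c * (W * (L * P))) ≤ μ * P ^ 2 / 2 + 2 * c ^ 2 * L ^ 2 / μ * W ^ 2 := by
    have e : μ * P ^ 2 / 2 + 2 * c ^ 2 * L ^ 2 / μ * W ^ 2 - 2 * (c * (W * (L * P)))
        = (μ * P - 2 * c * L * W) ^ 2 / (2 * μ) := by field_simp; ring
    have : 0 ≤ (μ * P - 2 * c * L * W) ^ 2 / (2 * μ) := by positivity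
    linarith
  have h2 : γ / k * (2 * c ^ 2 * L ^ 2 / μ * W ^ 2) ≤ W ^ 2 / (2 * k) := by
    calc γ / k * (2 * c ^ 2 * L ^ 2 / μ * W ^ 2)
        = 4 * (γ * L ^ 2) * (c ^ 2 / (2 * μ * k) * W ^ 2) := by field_simp; ring
      _ ≤ μ * k ^ 2 * (c ^ 2 / (2 * μ * k) * W ^ 2) := by gcongr
      _ = (c * k) ^ 2 * (W ^ 2 / (2 * k)) := by field_simp
      _ ≤ 1 * (W ^ 2 / (2 * k)) := by
        gcongr
        have : 0 ≤ c * k := by positivity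
        nlinarith
      _ = _ := one_mul _
  have := mul_le_mul_of_nonneg_left h1 hg.le
  nlinarith

theorem lyapunov_momentum_term_le {μ L γ k P : ℝ} (hk : 0 < k) (hk1 : k ≤ 1) (hγ : 0 < γ)
    (hγL : 4 * (γ * L ^ 2) ≤ μ * k ^ 2) (w h : E) (hh2 : ‖h‖ ^ 2 ≤ L ^ 2 * P ^ 2) :
    ‖(1 - k) • w - γ • h‖ ^ 2 ≤ (1 - k) * ‖w‖ ^ 2 + γ * μ * k * P ^ 2 / 4 := by
  -- `(1 - k) w - γ h` is a convex combination of `w` and `-(γ / k) h` with weights `1 - k` and `k`.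
  have hc1 : ‖(1 - k) • w - γ • h‖ ≤ (1 - k) * ‖w‖ + k * (γ / k * ‖h‖) := by
    refine (norm_sub_le _ _).trans (le_of_eq ?_)
    rw [norm_smul, norm_smul, Real.norm_eq_abs, Real.norm_eq_abs, abs_of_nonneg (by linarith),
      abs_of_pos hγ, ← mul_assoc, mul_div_cancel₀ _ hk.ne']
  have hc2 : ((1 - k) * ‖w‖ + k * (γ / k * ‖h‖)) ^ 2
      ≤ (1 - k) * ‖w‖ ^ 2 + k * (γ / k * ‖h‖) ^ 2 := by
    have : 0 ≤ (1 - k) * k * (‖w‖ - γ / k * ‖h‖) ^ 2 :=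
      mul_nonneg (mul_nonneg (by linarith) hk.le) (sq_nonneg _)
    nlinarith
  have hc3 : k * (γ / k * ‖h‖) ^ 2 ≤ γ * μ * k * P ^ 2 / 4 := by
    calc k * (γ / k * ‖h‖) ^ 2 = k * (γ / k) ^ 2 * ‖h‖ ^ 2 := by ring
      _ ≤ k * (γ / k) ^ 2 * (L ^ 2 * P ^ 2) := by gcongr
      _ = 4 * (γ * L ^ 2) * (γ * P ^ 2 / (4 * k)) := by field_simp
      _ ≤ μ * k ^ 2 * (γ * P ^ 2 / (4 * k)) := by gcongr
      _ = γ * μ * k * P ^ 2 / 4 := by field_simp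
  have := pow_le_pow_left₀ (norm_nonneg _) hc1 2
  linarith

/-- Without noise and drift, the step contracts `‖y‖² + ‖w‖² / k²`. -/
theorem lyapunov_contract {H : E →L[ℝ] E} {μ L γ k c : ℝ} (hμ : 0 < μ)
    (hH : ∀ v, ‖H v‖ ≤ L * ‖v‖) (hHm : ∀ v, μ * ‖v‖ ^ 2 ≤ inner ℝ (H v) v) (hk : 0 < k)
    (hk1 : k ≤ 1) (hc : 0 ≤ c) (hck : c * k ≤ 1 - k) (hγ : 0 < γ)
    (hγL : 4 * (γ * L ^ 2) ≤ μ * k ^ 2) (hq : 4 * (γ * μ) ≤ k ^ 2) (y w : E) :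
    ‖y - (γ / k) • H (y - c • w)‖ ^ 2 + ‖(1 - k) • w - γ • H (y - c • w)‖ ^ 2 / k ^ 2
      ≤ (1 - γ * μ / k / 2) * (‖y‖ ^ 2 + ‖w‖ ^ 2 / k ^ 2) := by
  set p := y - c • w with hp
  set h := H p with hh
  have hy : y = p + c • w := by rw [hp]; abel
  have hhn : ‖h‖ ≤ L * ‖p‖ := hH p
  have hh2 : ‖h‖ ^ 2 ≤ L ^ 2 * ‖p‖ ^ 2 := by
    rw [← mul_pow]; exact pow_le_pow_left₀ (norm_nonneg _) hhn 2
  set P := ‖p‖ with hP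
  set W := ‖w‖ with hW
  have hP0 : 0 ≤ P := norm_nonneg _
  have hW0 : 0 ≤ W := norm_nonneg _
  -- Monotonicity applies at `p`, so `inner ℝ y h` is split along `y = p + c w`.
  have hin : μ * P ^ 2 - c * (W * (L * P)) ≤ inner ℝ y h := by
    rw [hy, inner_add_left, real_inner_smul_left]
    have h1 : μ * P ^ 2 ≤ inner ℝ p h := by rw [real_inner_comm]; exact hHm p
    have h2 : -(W * (L * P)) ≤ inner ℝ w h := by
      have := abs_real_inner_le_norm w h
      have h3 : W * ‖h‖ ≤ W * (L * P) := mul_le_mul_of_nonneg_left hhn hW0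
      linarith [(abs_le.1 this).1]
    have := mul_le_mul_of_nonneg_left h2 hc
    linarith
  have hY : ‖y - (γ / k) • h‖ ^ 2 = ‖y‖ ^ 2 - 2 * (γ / k) * inner ℝ y h + (γ / k) ^ 2 * ‖h‖ ^ 2 := by
    rw [norm_sub_sq_real, real_inner_smul_right, norm_smul, Real.norm_eq_abs, mul_pow, sq_abs]; ring
  have hg : 0 < γ / k := by positivity
  -- the quadratic gradient term
  have hq1 : (γ / k) ^ 2 * ‖h‖ ^ 2 ≤ γ / k * μ * P ^ 2 / 4 := by
    calc (γ / k) ^ 2 * ‖h‖ ^ 2 ≤ (γ / k) ^ 2 * (L ^ 2 * P ^ 2) := by gcongr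
      _ = γ * L ^ 2 * (γ / k ^ 2 * P ^ 2) := by ring
      _ ≤ μ * k ^ 2 / 4 * (γ / k ^ 2 * P ^ 2) := by gcongr; linarith
      _ = γ * μ * P ^ 2 / 4 := by field_simp
      _ ≤ γ / k * μ * P ^ 2 / 4 := by
        gcongr; rw [le_div_iff₀ hk]; nlinarith
  have hq2 := lyapunov_cross_term_le hμ hk hc hck hγ hγL P W
  have hW2 := lyapunov_momentum_term_le hk hk1 hγ hγL w h hh2
  rw [← hW] at hW2
  -- The decay `-q P²` left after the cross terms is turned into `-q ‖y‖² / 2`. This costs `q W² /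
  -- k²`, which the remaining dissipation covers because `q ≤ k / 4`.
  have hYP : ‖y‖ ^ 2 ≤ 2 * P ^ 2 + 2 * (W ^ 2 / k ^ 2) := by
    have h1 : ‖y‖ ≤ P + c * W := by
      rw [hy]; refine (norm_add_le _ _).trans ?_
      rw [norm_smul, Real.norm_eq_abs, abs_of_nonneg hc]
    have h2 : c * W ≤ W / k := by
      rw [le_div_iff₀ hk]; nlinarith
    have h3 : ‖y‖ ^ 2 ≤ (P + W / k) ^ 2 := pow_le_pow_left₀ (norm_nonneg _) (by linarith) 2
    rw [← div_pow]
    nlinarith [sq_nonneg (P - W / k)]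
  have hW3 : ‖(1 - k) • w - γ • h‖ ^ 2 / k ^ 2
      ≤ (1 - k) * (W ^ 2 / k ^ 2) + γ / k * μ * P ^ 2 / 4 := by
    calc _ ≤ ((1 - k) * W ^ 2 + γ * μ * k * P ^ 2 / 4) / k ^ 2 := by gcongr
      _ = _ := by field_simp
  have hqk : γ * μ / k ≤ k / 4 := by
    rw [div_le_iff₀ hk]; nlinarith
  have hWk : W ^ 2 / (2 * k) = k / 2 * (W ^ 2 / k ^ 2) := by field_simp
  rw [hWk] at hq2
  set V := W ^ 2 / k ^ 2 with hV
  have hV0 : 0 ≤ V := by positivity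
  have hqe : γ / k * μ = γ * μ / k := by ring
  rw [hqe] at hq1 hq2 hW3
  set q := γ * μ / k with hqdef
  have hq0 : 0 < q := by positivity
  have hm := mul_le_mul_of_nonneg_left hin (by positivity : 0 ≤ 2 * (γ / k))
  have hm2 : 2 * (γ / k) * (μ * P ^ 2) = 2 * q * P ^ 2 := by rw [hqdef]; ring
  have hm3 := mul_le_mul_of_nonneg_left hYP hq0.le
  have hm4 := mul_le_mul_of_nonneg_right hqk hV0
  rw [hY]
  have hqV : 0 ≤ q * V := by positivity
  rw [mul_sub, hm2] at hm
  clear_value V q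
  linarith

/-- The noiseless step with drift forcing `b`. -/
theorem lyapunov_step {H : E →L[ℝ] E} {μ L γ k c : ℝ} (hμ : 0 < μ)
    (hH : ∀ v, ‖H v‖ ≤ L * ‖v‖) (hHm : ∀ v, μ * ‖v‖ ^ 2 ≤ inner ℝ (H v) v) (hk : 0 < k)
    (hk1 : k ≤ 1) (hc : 0 ≤ c) (hck : c * k ≤ 1 - k) (hγ : 0 < γ)
    (hγL : 4 * (γ * L ^ 2) ≤ μ * k ^ 2) (hq : 4 * (γ * μ) ≤ k ^ 2) (y w b : E) :
    ‖y - (γ / k) • H (y - c • w) - k⁻¹ • b‖ ^ 2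
        + ‖k⁻¹ • ((1 - k) • w - γ • H (y - c • w) - b)‖ ^ 2
      ≤ (1 - γ * μ / k / 4) * (‖y‖ ^ 2 + ‖k⁻¹ • w‖ ^ 2) + 9 / (γ * μ * k) * ‖b‖ ^ 2 := by
  have hV := lyapunov_contract hμ hH hHm hk hk1 hc hck hγ hγL hq y w
  have hq0 : 0 < γ * μ / k := by positivity
  have hq4 : γ * μ / k ≤ 1 / 4 := by
    rw [div_le_iff₀ hk]; nlinarith
  -- With `ε = q / 4`, the rate `1 - q / 2` becomes `(1 + q / 4) (1 - q / 2) ≤ 1 - q / 4`. The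
  -- vector `b / k` enters both components, and `2 (1 + 4 / q) ≤ 9 / q` gives the constant `9`.
  have h1 := norm_sub_sq_le_young (y - (γ / k) • H (y - c • w)) (k⁻¹ • b)
    (by positivity : 0 < γ * μ / k / 4)
  have h2 := norm_sub_sq_le_young (k⁻¹ • ((1 - k) • w - γ • H (y - c • w))) (k⁻¹ • b)
    (by positivity : 0 < γ * μ / k / 4)
  rw [← smul_sub] at h2
  have hn : ∀ v : E, ‖k⁻¹ • v‖ ^ 2 = ‖v‖ ^ 2 / k ^ 2 := by
    intro v; rw [norm_smul, norm_inv, Real.norm_eq_abs, abs_of_pos hk]; field_simp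
  rw [hn ((1 - k) • w - γ • H (y - c • w)), hn b] at h2
  rw [hn b] at h1
  rw [hn w]
  have hb : (1 + 1 / (γ * μ / k / 4)) * (‖b‖ ^ 2 / k ^ 2) * 2 ≤ 9 / (γ * μ * k) * ‖b‖ ^ 2 := by
    have h3 : (1 + 1 / (γ * μ / k / 4)) * 2 ≤ 9 / (γ * μ / k) := by
      rw [le_div_iff₀ hq0]
      have : (1 + 1 / (γ * μ / k / 4)) * 2 * (γ * μ / k) = 2 * (γ * μ / k) + 8 := by
        field_simp; ring
      linarith
    calc (1 + 1 / (γ * μ / k / 4)) * (‖b‖ ^ 2 / k ^ 2) * 2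
        = (1 + 1 / (γ * μ / k / 4)) * 2 * (‖b‖ ^ 2 / k ^ 2) := by ring
      _ ≤ 9 / (γ * μ / k) * (‖b‖ ^ 2 / k ^ 2) := by gcongr
      _ = _ := by field_simp
  set q := γ * μ / k with hqdef
  set V := ‖y‖ ^ 2 + ‖w‖ ^ 2 / k ^ 2 with hVdef
  have hV0 : 0 ≤ V := by positivity
  have h3 := mul_le_mul_of_nonneg_left hV (by positivity : 0 ≤ 1 + q / 4)
  have h4 : (1 + q / 4) * ((1 - q / 2) * V) ≤ (1 - q / 4) * V := by
    nlinarith [mul_nonneg (sq_nonneg q) hV0]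
  linarith

theorem norm_sq_add_norm_sq_sub_smul (S₁ S₂ z : E) (r : ℝ) :
    ‖S₁ - r • z‖ ^ 2 + ‖S₂ - r • z‖ ^ 2
      = ‖S₁‖ ^ 2 + ‖S₂‖ ^ 2 - 2 * r * inner ℝ (S₁ + S₂) z + 2 * r ^ 2 * ‖z‖ ^ 2 := by
  rw [norm_sub_sq_real, norm_sub_sq_real, real_inner_smul_right, real_inner_smul_right,
    norm_smul, mul_pow, Real.norm_eq_abs, sq_abs, inner_add_left]
  ring

end Lyapunov

/-- Exponential moment of the Lyapunov function after adding the noise `-r ζ` to both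
components. -/
theorem SubGaussianUnder.lintegral_exp_lyapunov_le {d : ℕ} {α : Type*} [MeasurableSpace α]
    {ν : Measure α} [IsProbabilityMeasure ν] {ζ : α → Vec d} {σ : ℝ}
    (hs : SubGaussianUnder ν ζ σ) (hσ : 0 < σ) (hm : Measurable ζ) (hi : Integrable ζ ν)
    (h0 : ∫ x, ζ x ∂ν = 0) (hd : 0 < d) {r q l : ℝ} (hl : 0 ≤ l)
    (h1 : 128 * σ ^ 2 * l * r ^ 2 ≤ q) (h2 : 4 * d * l * r ^ 2 * σ ^ 2 ≤ 1) (S₁ S₂ : Vec d) :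
    ∫⁻ x, ENNReal.ofReal (Real.exp (l * (‖S₁ - r • ζ x‖ ^ 2 + ‖S₂ - r • ζ x‖ ^ 2))) ∂ν
      ≤ ENNReal.ofReal (Real.exp (l * ((1 + q / 8) * (‖S₁‖ ^ 2 + ‖S₂‖ ^ 2)
          + 2 * d * r ^ 2 * σ ^ 2))) := by
  have h := hs.lintegral_exp_inner_add_norm_sq_le hσ hm hi h0 hd ((-(2 * l * r)) • (S₁ + S₂))
    (η := 2 * l * r ^ 2) (by positivity) (by linarith)
  calc ∫⁻ x, ENNReal.ofReal (Real.exp (l * (‖S₁ - r • ζ x‖ ^ 2 + ‖S₂ - r • ζ x‖ ^ 2))) ∂ν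
      = ENNReal.ofReal (Real.exp (l * (‖S₁‖ ^ 2 + ‖S₂‖ ^ 2))) *
          ∫⁻ x, ENNReal.ofReal (Real.exp (inner ℝ ((-(2 * l * r)) • (S₁ + S₂)) (ζ x)
            + 2 * l * r ^ 2 * ‖ζ x‖ ^ 2)) ∂ν := by
        rw [← lintegral_const_mul _ (by fun_prop)]
        refine lintegral_congr fun x => ?_
        rw [← ENNReal.ofReal_mul (Real.exp_pos _).le, ← Real.exp_add,
          norm_sq_add_norm_sq_sub_smul, real_inner_smul_left]
        ring_nf
    _ ≤ ENNReal.ofReal (Real.exp (l * (‖S₁‖ ^ 2 + ‖S₂‖ ^ 2))) *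
          ENNReal.ofReal (Real.exp (2 * σ ^ 2 * ‖(-(2 * l * r)) • (S₁ + S₂)‖ ^ 2
            + d * (2 * l * r ^ 2) * σ ^ 2)) := by gcongr
    _ ≤ _ := by
        rw [← ENNReal.ofReal_mul (Real.exp_pos _).le, ← Real.exp_add]
        refine ENNReal.ofReal_le_ofReal (Real.exp_le_exp.2 ?_)
        have hpar : ‖S₁ + S₂‖ ^ 2 ≤ 2 * (‖S₁‖ ^ 2 + ‖S₂‖ ^ 2) := by
          have := pow_le_pow_left₀ (norm_nonneg _) (norm_add_le S₁ S₂) 2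
          nlinarith [sq_nonneg (‖S₁‖ - ‖S₂‖)]
        have e : 2 * σ ^ 2 * ‖(-(2 * l * r)) • (S₁ + S₂)‖ ^ 2
            = 8 * σ ^ 2 * l ^ 2 * r ^ 2 * ‖S₁ + S₂‖ ^ 2 := by
          rw [norm_smul, mul_pow, Real.norm_eq_abs, sq_abs]; ring
        rw [e]
        have h3 : 8 * σ ^ 2 * l ^ 2 * r ^ 2 * ‖S₁ + S₂‖ ^ 2
            ≤ 8 * σ ^ 2 * l ^ 2 * r ^ 2 * (2 * (‖S₁‖ ^ 2 + ‖S₂‖ ^ 2)) := by gcongr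
        -- Here `128 = 8 * 16`: the linear part contributes `16 σ² l² r²` times the squared state,
        -- to be at most `l q / 8` times it.
        have h4 := mul_le_mul_of_nonneg_right h1
          (by positivity : 0 ≤ l * (‖S₁‖ ^ 2 + ‖S₂‖ ^ 2) / 8)
        nlinarith

end SGDM

/-! ### Derivatives of monotone maps and their averages along segments -/

namespace SGDM

section AverageDerivative

variable {E : Type*} [NormedAddCommGroup E] [InnerProductSpace ℝ E]

theorem norm_fderiv_apply_le_of_lipschitz {f : E → E} {L : ℝ} (hL : 0 ≤ L)
    (hlip : ∀ x y, ‖f x - f y‖ ≤ L * ‖x - y‖) (x v : E) : ‖fderiv ℝ f x v‖ ≤ L * ‖v‖ :=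
  (fderiv ℝ f x).le_of_opNorm_le
    (norm_fderiv_le_of_lip' ℝ hL (Filter.Eventually.of_forall fun y => hlip y x)) v

theorem le_inner_fderiv_of_strongly_monotone {f : E → E} (hf : Differentiable ℝ f) {μ : ℝ}
    (hmono : ∀ x y, μ * ‖x - y‖ ^ 2 ≤ inner ℝ (f x - f y) (x - y)) (x v : E) :
    μ * ‖v‖ ^ 2 ≤ inner ℝ (fderiv ℝ f x v) v := by
  have hd : HasDerivAt (fun t : ℝ => f (x + t • v)) (fderiv ℝ f x v) 0 := by
    have h1 : HasDerivAt (fun t : ℝ => x + t • v) v 0 := by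
      simpa using ((hasDerivAt_id (0 : ℝ)).smul_const v).const_add x
    have h2 : HasFDerivAt f (fderiv ℝ f x) (x + (0 : ℝ) • v) := by
      simpa using (hf x).hasFDerivAt
    exact h2.comp_hasDerivAt 0 h1
  have hs := (hasDerivAt_iff_tendsto_slope.1 hd).inner (𝕜 := ℝ) (tendsto_const_nhds (x := v))
  refine ge_of_tendsto hs ?_
  filter_upwards [self_mem_nhdsWithin] with t ht
  have ht : t ≠ 0 := ht
  have h := hmono (x + t • v) x
  rw [add_sub_cancel_left, norm_smul, mul_pow, Real.norm_eq_abs, sq_abs, inner_smul_right] at h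
  rw [slope_def_module, sub_zero, zero_smul, add_zero, real_inner_smul_left]
  -- Factoring out `t⁻¹ * t⁻¹ ≥ 0` treats both signs of `t` at once.
  have h3 : μ * ‖v‖ ^ 2 = t⁻¹ * (t⁻¹ * (μ * (t ^ 2 * ‖v‖ ^ 2))) := by field_simp
  have h4 : t⁻¹ * inner ℝ (f (x + t • v) - f x) v
      = t⁻¹ * (t⁻¹ * (t * inner ℝ (f (x + t • v) - f x) v)) := by field_simp
  rw [h3, h4]
  simpa only [mul_assoc] using mul_le_mul_of_nonneg_left h (mul_self_nonneg t⁻¹)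

variable [FiniteDimensional ℝ E]

/-- The derivative need not be continuous: it is measurable as a derivative, and bounded by the
Lipschitz constant. -/
theorem intervalIntegrable_fderiv_segment {f : E → E} {L : ℝ} (hL : 0 ≤ L)
    (hlip : ∀ x y, ‖f x - f y‖ ≤ L * ‖x - y‖) (a b : E) :
    IntervalIntegrable (fun s : ℝ => fderiv ℝ f (a + s • (b - a))) volume 0 1 := by
  borelize E
  have : CompleteSpace E := FiniteDimensional.complete ℝ E
  have : ProperSpace (E →L[ℝ] E) := FiniteDimensional.proper ℝ (E →L[ℝ] E)
  have hm : Measurable (fun s : ℝ => fderiv ℝ f (a + s • (b - a))) :=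
    (measurable_fderiv ℝ f).comp (by fun_prop)
  refine (intervalIntegrable_const (c := L)).mono_fun hm.aestronglyMeasurable ?_
  refine ae_of_all _ fun s => ?_
  refine (norm_fderiv_le_of_lip' ℝ hL (Filter.Eventually.of_forall fun y => hlip y _)).trans ?_
  exact le_abs_self _

theorem norm_average_fderiv_apply_le {f : E → E} {L : ℝ} (hL : 0 ≤ L)
    (hlip : ∀ x y, ‖f x - f y‖ ≤ L * ‖x - y‖) (a b v : E) :
    ‖(∫ s in (0 : ℝ)..1, fderiv ℝ f (a + s • (b - a))) v‖ ≤ L * ‖v‖ := by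
  have : CompleteSpace E := FiniteDimensional.complete ℝ E
  rw [ContinuousLinearMap.intervalIntegral_apply (intervalIntegrable_fderiv_segment hL hlip a b)]
  simpa using intervalIntegral.norm_integral_le_of_norm_le_const (a := (0 : ℝ)) (b := 1)
    (f := fun s => fderiv ℝ f (a + s • (b - a)) v)
    fun s _ => norm_fderiv_apply_le_of_lipschitz hL hlip _ v

theorem le_inner_average_fderiv {f : E → E} (hf : Differentiable ℝ f) {L μ : ℝ} (hL : 0 ≤ L)
    (hlip : ∀ x y, ‖f x - f y‖ ≤ L * ‖x - y‖)
    (hmono : ∀ x y, μ * ‖x - y‖ ^ 2 ≤ inner ℝ (f x - f y) (x - y)) (a b v : E) :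
    μ * ‖v‖ ^ 2 ≤ inner ℝ ((∫ s in (0 : ℝ)..1, fderiv ℝ f (a + s • (b - a))) v) v := by
  have : CompleteSpace E := FiniteDimensional.complete ℝ E
  have hi := intervalIntegrable_fderiv_segment hL hlip a b
  have hc := (((innerSL ℝ v).comp
    (ContinuousLinearMap.apply ℝ E v)).intervalIntegral_comp_comm hi)
  have hi2 : IntervalIntegrable (fun s : ℝ => inner ℝ v (fderiv ℝ f (a + s • (b - a)) v))
      volume 0 1 :=
    ⟨((innerSL ℝ v).comp (ContinuousLinearMap.apply ℝ E v)).integrable_comp hi.1,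
      ((innerSL ℝ v).comp (ContinuousLinearMap.apply ℝ E v)).integrable_comp hi.2⟩
  simp only [ContinuousLinearMap.comp_apply, ContinuousLinearMap.apply_apply,
    innerSL_apply_apply] at hc
  rw [real_inner_comm, ← hc]
  have h := intervalIntegral.integral_mono_on (μ := volume) (zero_le_one' ℝ)
    (intervalIntegrable_const (c := μ * ‖v‖ ^ 2)) hi2 fun s _ => by
      rw [real_inner_comm]
      exact le_inner_fderiv_of_strongly_monotone hf hmono _ v
  simpa using h

/-- Fundamental theorem of calculus along the segment, for an everywhere differentiable map with
integrable derivative. With `a` the minimizer, it makes the gradient step linear in the error. -/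
theorem average_fderiv_apply_sub {f : E → E} (hf : Differentiable ℝ f) {L : ℝ} (hL : 0 ≤ L)
    (hlip : ∀ x y, ‖f x - f y‖ ≤ L * ‖x - y‖) (a b : E) :
    (∫ s in (0 : ℝ)..1, fderiv ℝ f (a + s • (b - a))) (b - a) = f b - f a := by
  have : CompleteSpace E := FiniteDimensional.complete ℝ E
  have hi := intervalIntegrable_fderiv_segment hL hlip a b
  rw [ContinuousLinearMap.intervalIntegral_apply hi]
  have hi2 : IntervalIntegrable (fun s : ℝ => fderiv ℝ f (a + s • (b - a)) (b - a)) volume 0 1 :=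
    ⟨(ContinuousLinearMap.apply ℝ E (b - a)).integrable_comp hi.1,
      (ContinuousLinearMap.apply ℝ E (b - a)).integrable_comp hi.2⟩
  rw [intervalIntegral.integral_eq_sub_of_hasDerivAt (f := fun s : ℝ => f (a + s • (b - a)))
    (fun s _ => ?_) hi2]
  · simp
  · have h1 : HasDerivAt (fun t : ℝ => a + t • (b - a)) (b - a) s := by
      simpa using ((hasDerivAt_id s).smul_const (b - a)).const_add a
    exact (hf _).hasFDerivAt.comp_hasDerivAt s h1

end AverageDerivative

end SGDM

/-! ### Regular conditional laws and measurability -/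

namespace SGDM

/-- Each partial derivative is a pointwise limit of the jointly measurable difference quotients with
step `1 / (n + 1)`. -/
theorem measurable_gradient_of_measurable_uncurry {d : ℕ} {𝒳 : Type*} [MeasurableSpace 𝒳]
    {g : Vec d → 𝒳 → ℝ} (hg : Measurable (Function.uncurry g))
    (hd : ∀ x, Differentiable ℝ (fun θ => g θ x)) :
    Measurable fun p : Vec d × 𝒳 => gradient (fun θ => g θ p.2) p.1 := by
  suffices h : ∀ i : Fin d, Measurable fun p : Vec d × 𝒳 => gradient (fun θ => g θ p.2) p.1 i by
    have h2 : Measurable fun p : Vec d × 𝒳 => fun i => gradient (fun θ => g θ p.2) p.1 i :=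
      measurable_pi_lambda _ h
    exact (WithLp.measurable_toLp 2 _).comp h2
  intro i
  set e : Vec d := EuclideanSpace.single i (1 : ℝ) with he
  have hlim : ∀ p : Vec d × 𝒳, Filter.Tendsto
      (fun n : ℕ => ((n : ℝ) + 1) * (g (p.1 + ((n : ℝ) + 1)⁻¹ • e) p.2 - g p.1 p.2))
      Filter.atTop (nhds (gradient (fun θ => g θ p.2) p.1 i)) := by
    intro p
    have hl : HasLineDerivAt ℝ (fun θ => g θ p.2) (gradient (fun θ => g θ p.2) p.1 i) p.1 e := by
      have := ((hd p.2 p.1).hasGradientAt.hasFDerivAt).hasLineDerivAt e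
      rwa [InnerProductSpace.toDual_apply_apply, he, EuclideanSpace.inner_single_right, one_mul] at this
    have ht : Filter.Tendsto (fun n : ℕ => ((n : ℝ) + 1)⁻¹) Filter.atTop (nhdsWithin 0 {0}ᶜ) := by
      rw [tendsto_nhdsWithin_iff]
      refine ⟨by simpa using tendsto_one_div_add_atTop_nhds_zero_nat (𝕜 := ℝ), ?_⟩
      exact Filter.Eventually.of_forall fun n => by
        have : (0 : ℝ) < (n : ℝ) + 1 := by positivity
        simpa using this.ne'
    have := hl.tendsto_slope_zero.comp ht
    simpa [Function.comp_def] using this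
  refine measurable_of_tendsto_metrizable (fun n => ?_) (tendsto_pi_nhds.2 hlim)
  have h1 : Measurable fun p : Vec d × 𝒳 => g (p.1 + ((n : ℝ) + 1)⁻¹ • e) p.2 :=
    hg.comp (by fun_prop : Measurable fun p : Vec d × 𝒳 => (p.1 + ((n : ℝ) + 1)⁻¹ • e, p.2))
  have h2 : Measurable fun p : Vec d × 𝒳 => g p.1 p.2 := hg
  exact (h1.sub h2).const_mul _

/-- Rectangles determine the joint law of `(π, Y)`. In the application `Ω'` is `Ω` with the smaller
σ-algebra and `π` is the identity. -/
theorem lintegral_eq_of_forall_inter {Ω Ω' 𝒳 : Type*} [MeasurableSpace Ω] [MeasurableSpace Ω']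
    [MeasurableSpace 𝒳] {P : Measure Ω} [IsProbabilityMeasure P] {π : Ω → Ω'} (hπ : Measurable π)
    {Y : Ω → 𝒳} (hY : Measurable Y) (κ : Kernel Ω' 𝒳) [IsMarkovKernel κ]
    (h : ∀ B, MeasurableSet B → ∀ A, MeasurableSet A →
      P (π ⁻¹' B ∩ Y ⁻¹' A) = ∫⁻ ω in π ⁻¹' B, κ (π ω) A ∂P)
    {Φ : Ω' × 𝒳 → ENNReal} (hΦ : Measurable Φ) :
    ∫⁻ ω, Φ (π ω, Y ω) ∂P = ∫⁻ ω, ∫⁻ x, Φ (π ω, x) ∂κ (π ω) ∂P := by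
  have : IsProbabilityMeasure (P.map π) := Measure.isProbabilityMeasure_map hπ.aemeasurable
  have heq : P.map (fun ω => (π ω, Y ω)) = (P.map π) ⊗ₘ κ := by
    refine Measure.ext_prod fun {B A} hB hA => ?_
    rw [Measure.map_apply (hπ.prodMk hY) (hB.prod hA), Measure.compProd_apply_prod hB hA,
      setLIntegral_map hB (κ.measurable_coe hA) hπ, ← h B hB A hA]
    rfl
  have h1 : ∫⁻ z, Φ z ∂P.map (fun ω => (π ω, Y ω)) = ∫⁻ ω, Φ (π ω, Y ω) ∂P :=
    lintegral_map hΦ (hπ.prodMk hY)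
  rw [← h1, heq, Measure.lintegral_compProd hΦ, lintegral_map hΦ.lintegral_kernel_prod_right' hπ]

theorem ae_le_of_forall_preimage_lintegral_le {Ω Ω' : Type*} [MeasurableSpace Ω]
    [MeasurableSpace Ω'] {P : Measure Ω} [IsProbabilityMeasure P] {π : Ω → Ω'} (hπ : Measurable π)
    {G : Ω' → ENNReal} (hG : Measurable G) {c : ENNReal}
    (h : ∀ B, MeasurableSet B → ∫⁻ ω in π ⁻¹' B, G (π ω) ∂P ≤ c * P (π ⁻¹' B)) :
    ∀ᵐ ω ∂P, G (π ω) ≤ c := by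
  have : IsProbabilityMeasure (P.map π) := Measure.isProbabilityMeasure_map hπ.aemeasurable
  refine ae_of_ae_map hπ.aemeasurable (p := fun z => G z ≤ c)
    (ae_le_of_forall_setLIntegral_le_of_sigmaFinite hG (g := fun _ => c) fun B hB _ => ?_)
  rw [setLIntegral_map hB hG hπ, setLIntegral_const, Measure.map_apply hπ hB]
  exact h B hB

theorem measurable_gradient_comp {Ω 𝒳 : Type*} [MeasurableSpace Ω] [MeasurableSpace 𝒳] {d : ℕ}
    {g : Vec d → 𝒳 → ℝ} (hg : Measurable (Function.uncurry g))
    (hd : ∀ x, Differentiable ℝ (fun θ => g θ x)) {ψ : Ω → Vec d} (hψ : Measurable ψ) :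
    Measurable fun p : Ω × 𝒳 => gradient (fun θ => g θ p.2) (ψ p.1) :=
  (measurable_gradient_of_measurable_uncurry hg hd).comp
    (by fun_prop : Measurable fun p : Ω × 𝒳 => (ψ p.1, p.2))

theorem measurable_meanGrad_kernel {Ω 𝒳 : Type*} [MeasurableSpace Ω] [MeasurableSpace 𝒳] {d : ℕ}
    {g : Vec d → 𝒳 → ℝ} (hg : Measurable (Function.uncurry g))
    (hd : ∀ x, Differentiable ℝ (fun θ => g θ x)) {ψ : Ω → Vec d} (hψ : Measurable ψ)
    (κ : Kernel Ω 𝒳) [IsMarkovKernel κ] : Measurable fun ω => meanGrad g (κ ω) (ψ ω) :=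
  ((measurable_gradient_comp hg hd hψ).stronglyMeasurable.integral_kernel_prod_right'
    (κ := κ)).measurable

theorem measurable_noise_kernel {Ω 𝒳 : Type*} [MeasurableSpace Ω] [MeasurableSpace 𝒳] {d : ℕ}
    {g : Vec d → 𝒳 → ℝ} (hg : Measurable (Function.uncurry g))
    (hd : ∀ x, Differentiable ℝ (fun θ => g θ x)) {ψ : Ω → Vec d} (hψ : Measurable ψ)
    (κ : Kernel Ω 𝒳) [IsMarkovKernel κ] :
    Measurable fun p : Ω × 𝒳 => noise g (κ p.1) p.2 (ψ p.1) :=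
  (measurable_gradient_comp hg hd hψ).sub
    ((measurable_meanGrad_kernel hg hd hψ κ).comp measurable_fst)

theorem measurable_indicator_fst_mul {Ω 𝒳 : Type*} [MeasurableSpace Ω] [MeasurableSpace 𝒳]
    {B : Set Ω} (hB : MeasurableSet B) {Φ : Ω × 𝒳 → ENNReal} (hΦ : Measurable Φ) :
    Measurable fun p : Ω × 𝒳 => B.indicator (fun _ => (1 : ENNReal)) p.1 * Φ p :=
  ((measurable_const.indicator hB).comp measurable_fst).mul hΦ

/-! ### From conditional expectations to integrals under the conditional law -/

section RegCondLaw

variable {Ω 𝒳 : Type*} [MeasurableSpace 𝒳] {m : MeasurableSpace Ω} [mΩ : MeasurableSpace Ω]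
  {P : Measure Ω} {Y : Ω → 𝒳} {κ : Ω → Measure 𝒳}

/-- A regular conditional law as a kernel from the conditioning σ-algebra. -/
def IsRegCondLaw.kernel (h : IsRegCondLaw m P Y κ) : @Kernel Ω 𝒳 m _ :=
  @Kernel.mk Ω 𝒳 m _ κ h.measurable

theorem IsRegCondLaw.isMarkovKernel (h : IsRegCondLaw m P Y κ) :
    @IsMarkovKernel Ω 𝒳 m _ h.kernel :=
  @IsMarkovKernel.mk Ω 𝒳 m _ h.kernel h.isProbabilityMeasure

theorem IsRegCondLaw.isSFiniteKernel (h : IsRegCondLaw m P Y κ) :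
    @IsSFiniteKernel Ω 𝒳 m _ h.kernel :=
  have := h.isMarkovKernel
  inferInstance

theorem IsRegCondLaw.measurable_lintegral (h : IsRegCondLaw m P Y κ) {Φ : Ω × 𝒳 → ENNReal}
    (hΦ : Measurable[m.prod inferInstance] Φ) : Measurable[m] fun ω => ∫⁻ x, Φ (ω, x) ∂κ ω :=
  @Measurable.lintegral_kernel_prod_right' Ω 𝒳 m _ h.kernel
    h.isSFiniteKernel Φ hΦ

theorem IsRegCondLaw.measurable_meanGrad (h : IsRegCondLaw m P Y κ) {d : ℕ} {g : Vec d → 𝒳 → ℝ}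
    (hg : Measurable (Function.uncurry g)) (hd : ∀ x, Differentiable ℝ (fun θ => g θ x))
    {ψ : Ω → Vec d} (hψ : Measurable[m] ψ) : Measurable[m] fun ω => meanGrad g (κ ω) (ψ ω) :=
  @measurable_meanGrad_kernel Ω 𝒳 m _ d g hg hd ψ hψ h.kernel h.isMarkovKernel

theorem IsRegCondLaw.measurable_noise (h : IsRegCondLaw m P Y κ) {d : ℕ} {g : Vec d → 𝒳 → ℝ}
    (hg : Measurable (Function.uncurry g)) (hd : ∀ x, Differentiable ℝ (fun θ => g θ x))
    {ψ : Ω → Vec d} (hψ : Measurable[m] ψ) : Measurable[m.prod inferInstance]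
      fun p : Ω × 𝒳 => noise g (κ p.1) p.2 (ψ p.1) :=
  @measurable_noise_kernel Ω 𝒳 m _ d g hg hd ψ hψ h.kernel h.isMarkovKernel

variable [IsProbabilityMeasure P]

theorem IsRegCondLaw.measure_inter (h : IsRegCondLaw m P Y κ) (hm : m ≤ mΩ) (hY : Measurable Y)
    {B : Set Ω} (hB : MeasurableSet[m] B) {A : Set 𝒳} (hA : MeasurableSet A) :
    P (B ∩ Y ⁻¹' A) = ∫⁻ ω in B, κ ω A ∂P := by
  have hp := h.isProbabilityMeasure
  have hi : Integrable ((Y ⁻¹' A).indicator (fun _ => (1 : ℝ))) P :=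
    (integrable_const 1).indicator (hY hA)
  have h1 := setIntegral_condExp hm hi hB
  rw [← setIntegral_congr_ae (g := P[(Y ⁻¹' A).indicator (fun _ => (1 : ℝ)) | m])
    (hm _ hB) ((h.condProb_eq A hA).mono fun ω hω _ => hω), setIntegral_indicator (hY hA)] at h1
  have hmeas : Measurable fun ω => κ ω A :=
    ((Measure.measurable_coe hA).comp h.measurable).mono hm le_rfl
  have h2 : ∫ ω in B, (κ ω).real A ∂P = (∫⁻ ω in B, κ ω A ∂P).toReal :=
    integral_toReal hmeas.aemeasurable (ae_of_all _ fun ω => measure_lt_top _ _)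
  rw [h2] at h1
  have h3 : ∫⁻ ω in B, κ ω A ∂P ≠ ⊤ := by
    refine ne_top_of_le_ne_top (measure_ne_top P B) ?_
    calc ∫⁻ ω in B, κ ω A ∂P ≤ ∫⁻ _ in B, 1 ∂P := lintegral_mono fun ω => prob_le_one
      _ = P B := by simp
  refine (ENNReal.toReal_eq_toReal_iff' (measure_ne_top _ _) h3).1 ?_
  rw [h1]; simp [Measure.real]

theorem IsRegCondLaw.lintegral_eq (h : IsRegCondLaw m P Y κ) (hm : m ≤ mΩ) (hY : Measurable Y)
    {Φ : Ω × 𝒳 → ENNReal} (hΦ : Measurable[m.prod inferInstance] Φ) :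
    ∫⁻ ω, Φ (ω, Y ω) ∂P = ∫⁻ ω, ∫⁻ x, Φ (ω, x) ∂κ ω ∂P :=
  @lintegral_eq_of_forall_inter Ω Ω 𝒳 mΩ m _ P _ id (measurable_id'' hm) Y hY h.kernel
    h.isMarkovKernel (fun _ hB _ hA => h.measure_inter hm hY hB hA) Φ hΦ

/-- Both sides are tested on sets `B` of `m`: disintegration turns the kernel integral into an
integral over `B`, where the conditional expectation bound applies. -/
theorem IsRegCondLaw.ae_lintegral_le_two (h : IsRegCondLaw m P Y κ) (hm : m ≤ mΩ)
    (hY : Measurable Y) {f : Ω × 𝒳 → ℝ} (hf : Measurable[m.prod inferInstance] f)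
    (hi : Integrable (fun ω => Real.exp (f (ω, Y ω))) P)
    (h2 : ∀ᵐ ω ∂P, (P[fun ω => Real.exp (f (ω, Y ω)) | m]) ω ≤ 2) :
    ∀ᵐ ω ∂P, ∫⁻ x, ENNReal.ofReal (Real.exp (f (ω, x))) ∂κ ω ≤ 2 := by
  have hΦ : Measurable[m.prod inferInstance] fun p => ENNReal.ofReal (Real.exp (f p)) :=
    ENNReal.measurable_ofReal.comp (Real.measurable_exp.comp hf)
  refine @ae_le_of_forall_preimage_lintegral_le Ω Ω mΩ m P _ id (measurable_id'' hm) _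
    (h.measurable_lintegral hΦ) 2 fun B hB => ?_
  have hB' : MeasurableSet B := hm _ hB
  change ∫⁻ ω in B, ∫⁻ x, ENNReal.ofReal (Real.exp (f (ω, x))) ∂κ ω ∂P ≤ 2 * P B
  have hΨ : Measurable[m.prod inferInstance]
      fun p : Ω × 𝒳 => B.indicator (fun _ => (1 : ENNReal)) p.1 * ENNReal.ofReal (Real.exp (f p)) :=
    @measurable_indicator_fst_mul Ω 𝒳 m _ B hB _ hΦ
  have hdis := h.lintegral_eq hm hY hΨ
  have e1 : ∀ F : Ω → ENNReal, ∫⁻ ω, B.indicator (fun _ => (1 : ENNReal)) ω * F ω ∂P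
      = ∫⁻ ω in B, F ω ∂P := by
    intro F
    rw [← lintegral_indicator hB']
    refine lintegral_congr fun ω => ?_
    by_cases hω : ω ∈ B <;> simp [hω]
  have e2 : ∀ ω, ∫⁻ x, B.indicator (fun _ => (1 : ENNReal)) ω * ENNReal.ofReal (Real.exp (f (ω, x)))
      ∂κ ω = B.indicator (fun _ => (1 : ENNReal)) ω *
        ∫⁻ x, ENNReal.ofReal (Real.exp (f (ω, x))) ∂κ ω := by
    intro ω
    by_cases hω : ω ∈ B <;> simp [hω]
  simp only [e2, e1] at hdis
  rw [← hdis, ← ofReal_integral_eq_lintegral_ofReal hi.integrableOn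
    (ae_of_all _ fun ω => (Real.exp_pos _).le), ← setIntegral_condExp hm hi hB]
  have h3 : ∫ ω in B, (P[fun ω => Real.exp (f (ω, Y ω)) | m]) ω ∂P ≤ ∫ _ in B, (2 : ℝ) ∂P :=
    setIntegral_mono_ae integrable_condExp.integrableOn (integrable_const _).integrableOn h2
  refine (ENNReal.ofReal_le_ofReal h3).trans ?_
  rw [setIntegral_const, smul_eq_mul, ENNReal.ofReal_mul measureReal_nonneg,
    ofReal_measureReal, mul_comm, ENNReal.ofReal_ofNat]

/-- The exceptional null set depends on the direction `u`. A countable dense set of directions gives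
a common null set, and Fatou's lemma reaches the other directions. -/
theorem IsRegCondLaw.ae_subGaussianUnder (h : IsRegCondLaw m P Y κ) (hm : m ≤ mΩ)
    (hY : Measurable Y) {d : ℕ} {ζ : Ω × 𝒳 → Vec d} (hζ : Measurable[m.prod inferInstance] ζ)
    {σ : ℝ} (hs : CondSubGaussian m P (fun ω => ζ (ω, Y ω)) σ) :
    ∀ᵐ ω ∂P, SubGaussianUnder (κ ω) (fun x => ζ (ω, x)) σ := by
  obtain ⟨D, hDc, hDd⟩ := TopologicalSpace.exists_countable_dense (Metric.sphere (0 : Vec d) 1)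
  have hall : ∀ᵐ ω ∂P, ∀ u ∈ D, ∫⁻ x, ENNReal.ofReal
      (Real.exp ((|inner ℝ (u : Vec d) (ζ (ω, x))| / σ) ^ 2)) ∂κ ω ≤ 2 := by
    rw [ae_ball_iff hDc]
    intro u _
    obtain ⟨hi, h2⟩ := hs u (by simp)
    have hf : Measurable[m.prod inferInstance]
        fun p : Ω × 𝒳 => (|inner ℝ (u : Vec d) (ζ p)| / σ) ^ 2 :=
      (by fun_prop : Measurable fun z : Vec d => (|inner ℝ (u : Vec d) z| / σ) ^ 2).comp hζ
    exact h.ae_lintegral_le_two hm hY hf hi h2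
  filter_upwards [hall] with ω hω u hu
  have hmem : (⟨u, by simpa using hu⟩ : Metric.sphere (0 : Vec d) 1) ∈ closure D := hDd _
  obtain ⟨v, hvD, hv⟩ := mem_closure_iff_seq_limit.1 hmem
  have hv' : Filter.Tendsto (fun n => (v n : Vec d)) Filter.atTop (nhds u) :=
    (continuous_subtype_val.tendsto _).comp hv
  have hζω : Measurable fun x => ζ (ω, x) :=
    hζ.comp (@measurable_prodMk_left _ _ m _ ω)
  calc ∫⁻ x, ENNReal.ofReal (Real.exp ((|inner ℝ u (ζ (ω, x))| / σ) ^ 2)) ∂κ ω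
      = ∫⁻ x, Filter.liminf (fun n => ENNReal.ofReal
          (Real.exp ((|inner ℝ (v n : Vec d) (ζ (ω, x))| / σ) ^ 2))) Filter.atTop ∂κ ω := by
        refine lintegral_congr fun x => (Filter.Tendsto.liminf_eq ?_).symm
        have hc : Continuous fun z : Vec d =>
            ENNReal.ofReal (Real.exp ((|inner ℝ z (ζ (ω, x))| / σ) ^ 2)) :=
          ENNReal.continuous_ofReal.comp (by fun_prop)
        exact (hc.tendsto u).comp hv'
    _ ≤ Filter.liminf (fun n => ∫⁻ x, ENNReal.ofReal
          (Real.exp ((|inner ℝ (v n : Vec d) (ζ (ω, x))| / σ) ^ 2)) ∂κ ω) Filter.atTop :=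
        lintegral_liminf_le fun n =>
          (by fun_prop : Measurable fun z : Vec d => ENNReal.ofReal
            (Real.exp ((|inner ℝ (v n : Vec d) z| / σ) ^ 2))).comp hζω
    _ ≤ Filter.liminf (fun _ : ℕ => (2 : ENNReal)) Filter.atTop :=
        Filter.liminf_le_liminf (Filter.Eventually.of_forall fun n => hω _ (hvD n))
    _ = 2 := Filter.liminf_const _

end RegCondLaw

end SGDM

/-! ### Tracking errors in Lyapunov coordinates -/

namespace SGDM

section Coordinates

variable {d : ℕ}

/-- The previous tracking error `e_{t-1}`, with `e_{-1} = e_0`. -/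
def prevError (e : ℕ → Vec d) : ℕ → Vec d
  | 0 => e 0
  | t + 1 => e t

/-- The increment `w_t = e_t - e_{t-1}` of the tracking error. -/
def errorIncrement (e : ℕ → Vec d) (t : ℕ) : Vec d := e t - prevError e t

/-- The shifted error `y_t = e_t + ((1 - k) / k) w_t`. -/
noncomputable def shiftedError (k : ℝ) (e : ℕ → Vec d) (t : ℕ) : Vec d :=
  e t + ((1 - k) / k) • errorIncrement e t

/-- The Lyapunov function `‖y_t‖² + ‖w_t / k‖²`. -/
noncomputable def lyapunov (k : ℝ) (e : ℕ → Vec d) (t : ℕ) : ℝ :=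
  ‖shiftedError k e t‖ ^ 2 + ‖k⁻¹ • errorIncrement e t‖ ^ 2

theorem lyapunov_nonneg (k : ℝ) (e : ℕ → Vec d) (t : ℕ) : 0 ≤ lyapunov k e t := by
  unfold lyapunov; positivity

theorem lyapunov_zero (k : ℝ) (e : ℕ → Vec d) : lyapunov k e 0 = ‖e 0‖ ^ 2 := by
  simp [lyapunov, shiftedError, errorIncrement, prevError]

theorem norm_sq_le_lyapunov {k : ℝ} (hk : 0 < k) (hk1 : k ≤ 1) (e : ℕ → Vec d) (t : ℕ) :
    ‖e t‖ ^ 2 ≤ 2 * lyapunov k e t := by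
  have h : e t = shiftedError k e t - (1 - k) • (k⁻¹ • errorIncrement e t) := by
    rw [shiftedError, smul_smul, div_eq_mul_inv]; abel
  unfold lyapunov
  set y := shiftedError k e t
  set z := k⁻¹ • errorIncrement e t
  have h1 : ‖e t‖ ≤ ‖y‖ + ‖z‖ := by
    rw [h]
    refine (norm_sub_le _ _).trans ?_
    rw [norm_smul, Real.norm_eq_abs, abs_of_nonneg (by linarith)]
    nlinarith [norm_nonneg z]
  have h2 := pow_le_pow_left₀ (norm_nonneg _) h1 2
  nlinarith [sq_nonneg (‖y‖ - ‖z‖)]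

/-- The shifted error after a step whose new tracking error is `a`. -/
noncomputable def nextShifted (k : ℝ) (e : ℕ → Vec d) (t : ℕ) (a : Vec d) : Vec d :=
  a + ((1 - k) / k) • (a - e t)

/-- The scaled increment after a step whose new tracking error is `a`. -/
noncomputable def nextIncrement (k : ℝ) (e : ℕ → Vec d) (t : ℕ) (a : Vec d) : Vec d := k⁻¹ • (a - e t)

/-- The noise coefficient is `γ (1 + (1 - k) / k) = γ / k` for the shifted error and `γ / k` for the
scaled increment: the coordinates are scaled to make them equal. -/
theorem lyapunov_succ {k : ℝ} (hk : 0 < k) (e : ℕ → Vec d) (t : ℕ) (a z : Vec d) (γ : ℝ)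
    (h : e (t + 1) = a - γ • z) :
    lyapunov k e (t + 1) = ‖nextShifted k e t a - (γ / k) • z‖ ^ 2
      + ‖nextIncrement k e t a - (γ / k) • z‖ ^ 2 := by
  have h1 : shiftedError k e (t + 1) = nextShifted k e t a - (γ / k) • z := by
    have : γ / k = γ + (1 - k) / k * γ := by field_simp; ring
    rw [this]
    simp only [shiftedError, errorIncrement, prevError, nextShifted, h]
    module
  have h2 : k⁻¹ • errorIncrement e (t + 1) = nextIncrement k e t a - (γ / k) • z := by
    simp only [errorIncrement, prevError, nextIncrement, h]
    rw [div_eq_mul_inv]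
    module
  rw [lyapunov, h1, h2]

end Coordinates

/-! ### The momentum recursion along one data path -/

section Path

variable {d : ℕ} {𝒳 : Type*} (g : Vec d → 𝒳 → ℝ) (γ β₁ β₂ : ℝ) (θ₀ : Vec d)
  (x : ℕ → 𝒳)

theorem state_increment_eq (θs : ℕ → Vec d) (t : ℕ) :
    (state g γ β₁ β₂ θ₀ x t).1 - (state g γ β₁ β₂ θ₀ x t).2.1
      = errorIncrement (fun n => theta g γ β₁ β₂ θ₀ x n - θs n) t - prevDrift θs t := by
  cases t with
  | zero => simp [state, errorIncrement, prevError, prevDrift]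
  | succ t =>
    have h : (state g γ β₁ β₂ θ₀ x (t + 1)).2.1 = theta g γ β₁ β₂ θ₀ x t := rfl
    have h' : (state g γ β₁ β₂ θ₀ x (t + 1)).1 = theta g γ β₁ β₂ θ₀ x (t + 1) := rfl
    rw [h, h']
    simp only [errorIncrement, prevError, prevDrift, drift]
    abel

variable {β₁ β₂} in
-- If `β₂ ≠ 0` then `β₁ = 0`, and the look-ahead point is the iterate itself. This merges the two
-- momentum schemes.
theorem smul_psi_sub_prev (h : β₁ * β₂ = 0) (t : ℕ) :
    β₂ • (psi g γ β₁ β₂ θ₀ x t - (state g γ β₁ β₂ θ₀ x t).2.2)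
      = β₂ • ((state g γ β₁ β₂ θ₀ x t).1 - (state g γ β₁ β₂ θ₀ x t).2.1) := by
  rcases mul_eq_zero.1 h with rfl | rfl
  · congr 1
    cases t with
    | zero => simp [psi, state]
    | succ t => simp [psi, state]
  · simp

variable [MeasurableSpace 𝒳]

/-- The next iterate with the mean gradient in place of the stochastic gradient. -/
noncomputable def meanStep (ν : Measure 𝒳) (t : ℕ) : Vec d :=
  psi g γ β₁ β₂ θ₀ x t - γ • meanGrad g ν (psi g γ β₁ β₂ θ₀ x t)
    + β₂ • (psi g γ β₁ β₂ θ₀ x t - (state g γ β₁ β₂ θ₀ x t).2.2)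

theorem theta_succ_eq_meanStep_sub (ν : Measure 𝒳) (t : ℕ) :
    theta g γ β₁ β₂ θ₀ x (t + 1) = meanStep g γ β₁ β₂ θ₀ x ν t
      - γ • noise g ν (x (t + 1)) (psi g γ β₁ β₂ θ₀ x t) := by
  have h : theta g γ β₁ β₂ θ₀ x (t + 1) = psi g γ β₁ β₂ θ₀ x t
      - γ • gradient (fun θ => g θ (x (t + 1))) (psi g γ β₁ β₂ θ₀ x t)
      + β₂ • (psi g γ β₁ β₂ θ₀ x t - (state g γ β₁ β₂ θ₀ x t).2.2) := rfl
  rw [h, meanStep, noise]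
  module

variable {β₁ β₂} in
/-- The tracking error after the mean step, in terms of an operator `H` with
`H (ψ_t - θ⋆_{t+1}) = m_{t+1}(ψ_t)`. -/
theorem meanStep_sub_eq (h : β₁ * β₂ = 0) (θs : ℕ → Vec d) (ν : Measure 𝒳)
    (H : ℕ → Vec d →L[ℝ] Vec d) (t : ℕ)
    (hH : H t (psi g γ β₁ β₂ θ₀ x t - θs (t + 1)) = meanGrad g ν (psi g γ β₁ β₂ θ₀ x t)) :
    meanStep g γ β₁ β₂ θ₀ x ν t - θs (t + 1)
      = (theta g γ β₁ β₂ θ₀ x t - θs t)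
        + ((β₁ + β₂) • errorIncrement (fun n => theta g γ β₁ β₂ θ₀ x n - θs n) t
        - γ • H t ((theta g γ β₁ β₂ θ₀ x t - θs t)
          + β₁ • errorIncrement (fun n => theta g γ β₁ β₂ θ₀ x n - θs n) t)
        - forcing γ β₁ β₂ H θs t) := by
  have hψ : psi g γ β₁ β₂ θ₀ x t = theta g γ β₁ β₂ θ₀ x t
      + β₁ • (errorIncrement (fun n => theta g γ β₁ β₂ θ₀ x n - θs n) t - prevDrift θs t) := by
    rw [← state_increment_eq]; rfl
  rw [meanStep, smul_psi_sub_prev g γ θ₀ x h, state_increment_eq g γ β₁ β₂ θ₀ x θs, ← hH, hψ]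
  set w := errorIncrement (fun n => theta g γ β₁ β₂ θ₀ x n - θs n) t
  set θ := theta g γ β₁ β₂ θ₀ x t
  simp only [forcing, drift, neg_sub, sub_apply, smul_apply, neg_apply, add_apply,
    ContinuousLinearMap.id_apply, map_add, map_sub, map_smul]
  module

variable {g γ β₁ β₂ θ₀ x} in
theorem mean_lyapunov_le {ν : Measure 𝒳} {θs : ℕ → Vec d} {H : ℕ → Vec d →L[ℝ] Vec d} {t : ℕ}
    {μ L : ℝ} (hμ : 0 < μ) (hHL : ∀ v, ‖H t v‖ ≤ L * ‖v‖)
    (hHm : ∀ v, μ * ‖v‖ ^ 2 ≤ inner ℝ (H t v) v)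
    (hH : H t (psi g γ β₁ β₂ θ₀ x t - θs (t + 1)) = meanGrad g ν (psi g γ β₁ β₂ θ₀ x t))
    {k : ℝ} (hk : 0 < k) (hβ : β₁ + β₂ = 1 - k) (hβ₁ : 0 ≤ β₁) (hβ₂ : 0 ≤ β₂) (h : β₁ * β₂ = 0)
    (hγ : 0 < γ) (hγL : 4 * (γ * L ^ 2) ≤ μ * k ^ 2) (hq : 4 * (γ * μ) ≤ k ^ 2) :
    ‖nextShifted k (fun n => theta g γ β₁ β₂ θ₀ x n - θs n) t
          (meanStep g γ β₁ β₂ θ₀ x ν t - θs (t + 1))‖ ^ 2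
        + ‖nextIncrement k (fun n => theta g γ β₁ β₂ θ₀ x n - θs n) t
          (meanStep g γ β₁ β₂ θ₀ x ν t - θs (t + 1))‖ ^ 2
      ≤ (1 - γ * μ / k / 4) * lyapunov k (fun n => theta g γ β₁ β₂ θ₀ x n - θs n) t
        + 9 / (γ * μ * k) * ‖forcing γ β₁ β₂ H θs t‖ ^ 2 := by
  have hk1 : k ≤ 1 := by linarith
  -- The shift `c = (1 - k) / k - β₁` makes `y - c w = e + β₁ w`, the point at which `H` acts.
  have hc : 0 ≤ (1 - k) / k - β₁ := by
    rw [sub_nonneg, le_div_iff₀ hk]; nlinarith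
  have hck : ((1 - k) / k - β₁) * k ≤ 1 - k := by
    rw [sub_mul, div_mul_cancel₀ _ hk.ne']; nlinarith
  have hs := lyapunov_step hμ hHL hHm hk hk1 hc hck hγ hγL hq
    (shiftedError k (fun n => theta g γ β₁ β₂ θ₀ x n - θs n) t)
    (errorIncrement (fun n => theta g γ β₁ β₂ θ₀ x n - θs n) t) (forcing γ β₁ β₂ H θs t)
  have ha := meanStep_sub_eq g γ θ₀ x h θs ν H t hH
  rw [hβ] at ha
  have hp : shiftedError k (fun n => theta g γ β₁ β₂ θ₀ x n - θs n) t
      - ((1 - k) / k - β₁) • errorIncrement (fun n => theta g γ β₁ β₂ θ₀ x n - θs n) t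
      = (theta g γ β₁ β₂ θ₀ x t - θs t)
        + β₁ • errorIncrement (fun n => theta g γ β₁ β₂ θ₀ x n - θs n) t := by
    rw [shiftedError]; module
  rw [hp] at hs
  refine le_trans (le_of_eq ?_) hs
  have h1 : 1 + (1 - k) / k = k⁻¹ := by field_simp; ring
  congr 3
  · rw [nextShifted, ha, shiftedError]
    set w := errorIncrement (fun n => theta g γ β₁ β₂ θ₀ x n - θs n) t
    set b := forcing γ β₁ β₂ H θs t
    set e := theta g γ β₁ β₂ θ₀ x t - θs t
    set p := H t (e + β₁ • w)
    have h2 : (1 - k) / k = k⁻¹ - 1 := by linarith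
    have h3 : (1 - k) / k = k⁻¹ * (1 - k) := by ring
    have h4 : γ / k = k⁻¹ * γ := by ring
    calc _ = e + (1 + (1 - k) / k) • ((1 - k) • w - γ • p - b) := by module
      _ = e + k⁻¹ • ((1 - k) • w - γ • p - b) := by rw [h1]
      _ = _ := by rw [h3, h4]; module
  · rw [nextIncrement, ha, add_sub_cancel_left]

end Path

section RecursiveBudget

/-- The solution of `B_0 = v`, `B_{t+1} = r B_t + 2 D_t + c`. -/
def budget (r c v : ℝ) (D : ℕ → ℝ) : ℕ → ℝ
  | 0 => v
  | t + 1 => r * budget r c v D t + 2 * D t + c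

/-- The recursion contracts at rate `r`, but the bound is stated with the slower discount `ρ`. The
constant input is summed at rate `r`, with fixed point `c / (1 - r)`. -/
theorem budget_le {r ρ c v : ℝ} {D D' : ℕ → ℝ} (hr : 0 ≤ r) (hr1 : r < 1) (hrρ : r ≤ ρ)
    (hc : 0 ≤ c) (hv : 0 ≤ v) (hD' : ∀ t, 0 ≤ D' t) (hD : ∀ t, D t ≤ D' t) (T : ℕ) :
    budget r c v D T ≤ ρ ^ T * v + c / (1 - r)
      + 2 * ∑ l ∈ Finset.range T, ρ ^ (T - l - 1) * D' l := by
  have hρ : 0 ≤ ρ := hr.trans hrρ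
  have h1r : 0 < 1 - r := by linarith
  induction T with
  | zero =>
    have := div_nonneg hc h1r.le
    simp [budget, this]
  | succ T ih =>
    have hsum : ∑ l ∈ Finset.range (T + 1), ρ ^ (T + 1 - l - 1) * D' l
        = ρ * ∑ l ∈ Finset.range T, ρ ^ (T - l - 1) * D' l + D' T := by
      rw [Finset.sum_range_succ, Finset.mul_sum]
      congr 1
      · refine Finset.sum_congr rfl fun l hl => ?_
        have : T + 1 - l - 1 = (T - l - 1) + 1 := by
          have := Finset.mem_range.1 hl; omega
        rw [this, pow_succ]; ring
      · simp
    rw [hsum, budget]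
    have hS : 0 ≤ ∑ l ∈ Finset.range T, ρ ^ (T - l - 1) * D' l :=
      Finset.sum_nonneg fun l _ => mul_nonneg (pow_nonneg hρ _) (hD' l)
    set S := ∑ l ∈ Finset.range T, ρ ^ (T - l - 1) * D' l
    have h1 := mul_le_mul_of_nonneg_left ih hr
    have h2 : r * (ρ ^ T * v) ≤ ρ ^ (T + 1) * v := by
      rw [pow_succ', mul_assoc]
      exact mul_le_mul_of_nonneg_right hrρ (by positivity)
    have h3 : r * (c / (1 - r)) + c = c / (1 - r) := by field_simp; ring
    have h4 := mul_le_mul_of_nonneg_right hrρ hS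
    linarith [hD T]

end RecursiveBudget

end SGDM

/-! ### The exponential supermartingale -/

namespace SGDM

section Measurability

variable {d : ℕ} {Ω 𝒳 : Type*} [MeasurableSpace 𝒳]

theorem measurable_state_succ {m : MeasurableSpace Ω} {g : Vec d → 𝒳 → ℝ}
    (hg : Measurable (Function.uncurry g)) (hd : ∀ x, Differentiable ℝ (fun θ => g θ x))
    (γ β₁ β₂ : ℝ) {θ₀ : Ω → Vec d} {X : ℕ → Ω → 𝒳} {t : ℕ}
    (hs : Measurable fun ω => state g γ β₁ β₂ (θ₀ ω) (fun k => X k ω) t)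
    (hX : Measurable (X (t + 1))) :
    Measurable fun ω => state g γ β₁ β₂ (θ₀ ω) (fun k => X k ω) (t + 1) := by
  have h1 := hs.fst
  have h2 := hs.snd.fst
  have h3 := hs.snd.snd
  have hψ : Measurable fun ω => psi g γ β₁ β₂ (θ₀ ω) (fun k => X k ω) t :=
    h1.add ((h1.sub h2).const_smul β₁)
  have hG : Measurable fun ω => gradient (fun θ => g θ (X (t + 1) ω))
      (psi g γ β₁ β₂ (θ₀ ω) (fun k => X k ω) t) :=
    (measurable_gradient_of_measurable_uncurry hg hd).comp (hψ.prodMk hX)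
  exact ((hψ.sub (hG.const_smul γ)).add ((hψ.sub h3).const_smul β₂)).prodMk (h1.prodMk hψ)

theorem measurable_state {mΩ : MeasurableSpace Ω} {ℱ : Filtration ℕ mΩ} {g : Vec d → 𝒳 → ℝ}
    (hg : Measurable (Function.uncurry g)) (hd : ∀ x, Differentiable ℝ (fun θ => g θ x))
    (γ β₁ β₂ : ℝ) {θ₀ : Ω → Vec d} (hθ₀ : Measurable[ℱ 0] θ₀) {X : ℕ → Ω → 𝒳}
    (hX : ∀ t, Measurable[ℱ t] (X t)) (t : ℕ) :
    Measurable[ℱ t] fun ω => state g γ β₁ β₂ (θ₀ ω) (fun k => X k ω) t := by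
  induction t with
  | zero => exact hθ₀.prodMk (hθ₀.prodMk hθ₀)
  | succ t ih =>
    exact @measurable_state_succ d Ω 𝒳 _ (ℱ (t + 1)) g hg hd γ β₁ β₂ θ₀ X t
      (ih.mono (ℱ.mono (Nat.le_succ t)) le_rfl) (hX (t + 1))

theorem measurable_exp_lyapunov_noise {m : MeasurableSpace Ω} {S₁ S₂ : Ω → Vec d}
    (hS₁ : Measurable S₁) (hS₂ : Measurable S₂) {B : Ω → ℝ} (hB : Measurable B)
    {ζ : Ω × 𝒳 → Vec d} (hζ : Measurable ζ) (l r : ℝ) :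
    Measurable fun p : Ω × 𝒳 => ENNReal.ofReal (Real.exp
      (l * (‖S₁ p.1 - r • ζ p‖ ^ 2 + ‖S₂ p.1 - r • ζ p‖ ^ 2 - B p.1))) := by
  fun_prop

theorem measurable_lyapunov_of_measurable {m : MeasurableSpace Ω} {e : Ω → ℕ → Vec d} (k : ℝ)
    (t : ℕ) (he : Measurable fun ω => e ω t) (hp : Measurable fun ω => prevError (e ω) t) :
    Measurable fun ω => lyapunov k (e ω) t := by
  unfold lyapunov shiftedError errorIncrement
  fun_prop

theorem measurable_next_of_measurable {m : MeasurableSpace Ω} {e : Ω → ℕ → Vec d} {a : Ω → Vec d}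
    (k : ℝ) (t : ℕ) (ha : Measurable a) (he : Measurable fun ω => e ω t) :
    (Measurable fun ω => nextShifted k (e ω) t (a ω)) ∧
      Measurable fun ω => nextIncrement k (e ω) t (a ω) := by
  unfold nextShifted nextIncrement
  constructor <;> fun_prop

theorem measurable_max_zero_norm_sq {m : MeasurableSpace Ω} {S₁ S₂ : Ω → Vec d} {V : Ω → ℝ}
    (hS₁ : Measurable S₁) (hS₂ : Measurable S₂) (hV : Measurable V) (a : ℝ) :
    Measurable fun ω => max 0 (‖S₁ ω‖ ^ 2 + ‖S₂ ω‖ ^ 2 - a * V ω) := by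
  fun_prop

end Measurability

/-- One step of the exponential supermartingale. -/
theorem IsRegCondLaw.lintegral_exp_lyapunov_step {Ω 𝒳 : Type*} [MeasurableSpace 𝒳]
    {m : MeasurableSpace Ω} [mΩ : MeasurableSpace Ω] {P : Measure Ω} [IsProbabilityMeasure P]
    {Y : Ω → 𝒳} {κ : Ω → Measure 𝒳} (h : IsRegCondLaw m P Y κ) (hm : m ≤ mΩ) (hY : Measurable Y)
    {d : ℕ} (hd : 0 < d) {ζ : Ω × 𝒳 → Vec d} (hζ : Measurable[m.prod inferInstance] ζ) {σ : ℝ}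
    (hσ : 0 < σ) (hs : ∀ᵐ ω ∂P, SubGaussianUnder (κ ω) (fun x => ζ (ω, x)) σ)
    (hi : ∀ᵐ ω ∂P, Integrable (fun x => ζ (ω, x)) (κ ω) ∧ ∫ x, ζ (ω, x) ∂κ ω = 0)
    {S₁ S₂ : Ω → Vec d} (hS₁ : Measurable[m] S₁) (hS₂ : Measurable[m] S₂) {B U : Ω → ℝ}
    (hB : Measurable[m] B) {l r q : ℝ} (hl : 0 ≤ l) (h1 : 128 * σ ^ 2 * l * r ^ 2 ≤ q)
    (h2 : 4 * d * l * r ^ 2 * σ ^ 2 ≤ 1)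
    (hU : ∀ ω, (1 + q / 8) * (‖S₁ ω‖ ^ 2 + ‖S₂ ω‖ ^ 2) + 2 * d * r ^ 2 * σ ^ 2 - B ω ≤ U ω) :
    ∫⁻ ω, ENNReal.ofReal (Real.exp
        (l * (‖S₁ ω - r • ζ (ω, Y ω)‖ ^ 2 + ‖S₂ ω - r • ζ (ω, Y ω)‖ ^ 2 - B ω))) ∂P
      ≤ ∫⁻ ω, ENNReal.ofReal (Real.exp (l * U ω)) ∂P := by
  have hΦ := @measurable_exp_lyapunov_noise d Ω 𝒳 _ m S₁ S₂ hS₁ hS₂ B hB ζ hζ l r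
  refine (h.lintegral_eq hm hY hΦ).trans_le (lintegral_mono_ae ?_)
  filter_upwards [hs, hi] with ω hsω hiω
  have := h.isProbabilityMeasure ω
  have hζω : Measurable fun x => ζ (ω, x) := hζ.comp (@measurable_prodMk_left _ _ m _ ω)
  have hle := hsω.lintegral_exp_lyapunov_le hσ hζω hiω.1 hiω.2 hd hl h1 h2 (S₁ ω) (S₂ ω)
  calc ∫⁻ x, ENNReal.ofReal (Real.exp
          (l * (‖S₁ ω - r • ζ (ω, x)‖ ^ 2 + ‖S₂ ω - r • ζ (ω, x)‖ ^ 2 - B ω))) ∂κ ω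
      = ENNReal.ofReal (Real.exp (-(l * B ω))) * ∫⁻ x, ENNReal.ofReal (Real.exp
          (l * (‖S₁ ω - r • ζ (ω, x)‖ ^ 2 + ‖S₂ ω - r • ζ (ω, x)‖ ^ 2))) ∂κ ω := by
        have hf : Measurable fun x => ENNReal.ofReal
            (Real.exp (l * (‖S₁ ω - r • ζ (ω, x)‖ ^ 2 + ‖S₂ ω - r • ζ (ω, x)‖ ^ 2))) :=
          (by fun_prop : Measurable fun z : Vec d => ENNReal.ofReal
            (Real.exp (l * (‖S₁ ω - r • z‖ ^ 2 + ‖S₂ ω - r • z‖ ^ 2)))).comp hζω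
        rw [← lintegral_const_mul _ hf]
        refine lintegral_congr fun x => ?_
        rw [← ENNReal.ofReal_mul (Real.exp_pos _).le, ← Real.exp_add]
        ring_nf
    _ ≤ ENNReal.ofReal (Real.exp (-(l * B ω))) * ENNReal.ofReal (Real.exp
          (l * ((1 + q / 8) * (‖S₁ ω‖ ^ 2 + ‖S₂ ω‖ ^ 2) + 2 * d * r ^ 2 * σ ^ 2))) := by gcongr
    _ ≤ ENNReal.ofReal (Real.exp (l * U ω)) := by
        rw [← ENNReal.ofReal_mul (Real.exp_pos _).le, ← Real.exp_add]
        refine ENNReal.ofReal_le_ofReal (Real.exp_le_exp.2 ?_)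
        have := mul_le_mul_of_nonneg_left (hU ω) hl
        linarith

theorem ae_noise_integrable_and_integral_eq_zero {d : ℕ} {Ω 𝒳 : Type*} [MeasurableSpace 𝒳]
    [MeasurableSpace Ω] {P : Measure Ω} {κ : Ω → Measure 𝒳} (hκ : ∀ ω, IsProbabilityMeasure (κ ω))
    {g : Vec d → 𝒳 → ℝ}
    (hi : ∀ᵐ ω ∂P, ∀ θ, Integrable (fun x => gradient (fun θ' => g θ' x) θ) (κ ω))
    (ψ : Ω → Vec d) :
    ∀ᵐ ω ∂P, Integrable (fun x => noise g (κ ω) x (ψ ω)) (κ ω) ∧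
      ∫ x, noise g (κ ω) x (ψ ω) ∂κ ω = 0 := by
  filter_upwards [hi] with ω hω
  refine ⟨(hω (ψ ω)).sub (integrable_const _), ?_⟩
  simp only [noise]
  rw [integral_sub (hω (ψ ω)) (integrable_const _)]
  simp [meanGrad]

/-! ### The tracking error minus its predictable budget -/

section Supermartingale

variable {d : ℕ} {Ω 𝒳 : Type*} [MeasurableSpace 𝒳]

/-- The tracking errors `e_t = θ_t - θ⋆_t` along a path. -/
noncomputable def trackingError (g : Vec d → 𝒳 → ℝ) (γ β₁ β₂ : ℝ) (θs : ℕ → Ω → Vec d) (θ₀ : Ω → Vec d)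
    (X : ℕ → Ω → 𝒳) (ω : Ω) (t : ℕ) : Vec d :=
  theta g γ β₁ β₂ (θ₀ ω) (fun n => X n ω) t - θs t ω

/-- The predictable tracking error at time `t + 1`, before the noise is added. -/
noncomputable def meanError (g : Vec d → 𝒳 → ℝ) (γ β₁ β₂ : ℝ) (law : ℕ → Ω → Measure 𝒳)
    (θs : ℕ → Ω → Vec d) (θ₀ : Ω → Vec d) (X : ℕ → Ω → 𝒳) (t : ℕ) (ω : Ω) : Vec d :=
  meanStep g γ β₁ β₂ (θ₀ ω) (fun n => X n ω) (law (t + 1) ω) t - θs (t + 1) ω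

/-- The squared norm of the predictable Lyapunov state at time `t + 1`. -/
noncomputable def meanLyapunov (g : Vec d → 𝒳 → ℝ) (γ β₁ β₂ k : ℝ) (law : ℕ → Ω → Measure 𝒳)
    (θs : ℕ → Ω → Vec d) (θ₀ : Ω → Vec d) (X : ℕ → Ω → 𝒳) (ω : Ω) (t : ℕ) : ℝ :=
  ‖nextShifted k (trackingError g γ β₁ β₂ θs θ₀ X ω) t (meanError g γ β₁ β₂ law θs θ₀ X t ω)‖ ^ 2
    + ‖nextIncrement k (trackingError g γ β₁ β₂ θs θ₀ X ω) t
        (meanError g γ β₁ β₂ law θs θ₀ X t ω)‖ ^ 2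

/-- The excess of the predictable Lyapunov state over its contraction by the factor `a`. -/
noncomputable def driftExcess (g : Vec d → 𝒳 → ℝ) (γ β₁ β₂ k a : ℝ) (law : ℕ → Ω → Measure 𝒳)
    (θs : ℕ → Ω → Vec d) (θ₀ : Ω → Vec d) (X : ℕ → Ω → 𝒳) (ω : Ω) (t : ℕ) : ℝ :=
  max 0 (meanLyapunov g γ β₁ β₂ k law θs θ₀ X ω t
    - a * lyapunov k (trackingError g γ β₁ β₂ θs θ₀ X ω) t)

variable [mΩ : MeasurableSpace Ω] {P : Measure Ω} {ℱ : Filtration ℕ mΩ} {X : ℕ → Ω → 𝒳}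
  {law : ℕ → Ω → Measure 𝒳} {g : Vec d → 𝒳 → ℝ} {θs : ℕ → Ω → Vec d} {θ₀ : Ω → Vec d}

theorem IsTrackingProblem.measurable_trackingError (hp : IsTrackingProblem P ℱ X law g θs)
    (hθ₀ : Measurable[ℱ 0] θ₀) (γ β₁ β₂ : ℝ) (t : ℕ) :
    Measurable[ℱ t] fun ω => trackingError g γ β₁ β₂ θs θ₀ X ω t := by
  have hs := measurable_state hp.measurable_loss hp.differentiable_loss γ β₁ β₂ hθ₀ hp.adapted t
  refine (measurable_fst.comp hs).sub ?_
  cases t with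
  | zero => exact hp.measurable_star_zero
  | succ t => exact (hp.predictable_star t).mono (ℱ.mono (Nat.le_succ t)) le_rfl

theorem IsTrackingProblem.measurable_prevError (hp : IsTrackingProblem P ℱ X law g θs)
    (hθ₀ : Measurable[ℱ 0] θ₀) (γ β₁ β₂ : ℝ) (t : ℕ) :
    Measurable[ℱ t] fun ω => prevError (trackingError g γ β₁ β₂ θs θ₀ X ω) t := by
  cases t with
  | zero => exact hp.measurable_trackingError hθ₀ γ β₁ β₂ 0
  | succ t =>
    exact (hp.measurable_trackingError hθ₀ γ β₁ β₂ t).mono (ℱ.mono (Nat.le_succ t)) le_rfl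

theorem IsTrackingProblem.measurable_lyapunov (hp : IsTrackingProblem P ℱ X law g θs)
    (hθ₀ : Measurable[ℱ 0] θ₀) (γ β₁ β₂ k : ℝ) (t : ℕ) :
    Measurable[ℱ t] fun ω => lyapunov k (trackingError g γ β₁ β₂ θs θ₀ X ω) t := by
  have he := hp.measurable_trackingError hθ₀ γ β₁ β₂ t
  exact measurable_lyapunov_of_measurable k t he (hp.measurable_prevError hθ₀ γ β₁ β₂ t)

theorem IsTrackingProblem.measurable_psi (hp : IsTrackingProblem P ℱ X law g θs)
    (hθ₀ : Measurable[ℱ 0] θ₀) (γ β₁ β₂ : ℝ) (t : ℕ) :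
    Measurable[ℱ t] fun ω => psi g γ β₁ β₂ (θ₀ ω) (fun n => X n ω) t := by
  have hs := measurable_state hp.measurable_loss hp.differentiable_loss γ β₁ β₂ hθ₀ hp.adapted t
  have h1 := measurable_fst.comp hs
  exact h1.add ((h1.sub ((measurable_fst.comp measurable_snd).comp hs)).const_smul β₁)

theorem IsTrackingProblem.measurable_meanError (hp : IsTrackingProblem P ℱ X law g θs)
    (hθ₀ : Measurable[ℱ 0] θ₀) (γ β₁ β₂ : ℝ) (t : ℕ) :
    Measurable[ℱ t] (meanError g γ β₁ β₂ law θs θ₀ X t) := by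
  have hs := measurable_state hp.measurable_loss hp.differentiable_loss γ β₁ β₂ hθ₀ hp.adapted t
  have hψ := hp.measurable_psi hθ₀ γ β₁ β₂ t
  have hm := (hp.condLaw t).measurable_meanGrad hp.measurable_loss hp.differentiable_loss hψ
  exact ((hψ.sub (hm.const_smul γ)).add ((hψ.sub ((measurable_snd.comp measurable_snd).comp
    hs)).const_smul β₂)).sub (hp.predictable_star t)

theorem IsTrackingProblem.measurable_next (hp : IsTrackingProblem P ℱ X law g θs)
    (hθ₀ : Measurable[ℱ 0] θ₀) (γ β₁ β₂ k : ℝ) (t : ℕ) :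
    Measurable[ℱ t] (fun ω => nextShifted k (trackingError g γ β₁ β₂ θs θ₀ X ω) t
      (meanError g γ β₁ β₂ law θs θ₀ X t ω)) ∧
    Measurable[ℱ t] (fun ω => nextIncrement k (trackingError g γ β₁ β₂ θs θ₀ X ω) t
      (meanError g γ β₁ β₂ law θs θ₀ X t ω)) := by
  have ha := hp.measurable_meanError hθ₀ γ β₁ β₂ t
  exact measurable_next_of_measurable k t ha (hp.measurable_trackingError hθ₀ γ β₁ β₂ t)

theorem IsTrackingProblem.measurable_driftExcess (hp : IsTrackingProblem P ℱ X law g θs)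
    (hθ₀ : Measurable[ℱ 0] θ₀) (γ β₁ β₂ k a : ℝ) (t : ℕ) :
    Measurable[ℱ t] fun ω => driftExcess g γ β₁ β₂ k a law θs θ₀ X ω t := by
  obtain ⟨h1, h2⟩ := hp.measurable_next hθ₀ γ β₁ β₂ k t
  exact measurable_max_zero_norm_sq h1 h2 (hp.measurable_lyapunov hθ₀ γ β₁ β₂ k t) a

theorem IsTrackingProblem.measurable_budget (hp : IsTrackingProblem P ℱ X law g θs)
    (hθ₀ : Measurable[ℱ 0] θ₀) (γ β₁ β₂ k a r c : ℝ) (t : ℕ) :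
    Measurable[ℱ t] fun ω => budget r c (lyapunov k (trackingError g γ β₁ β₂ θs θ₀ X ω) 0)
      (driftExcess g γ β₁ β₂ k a law θs θ₀ X ω) t := by
  induction t with
  | zero => exact hp.measurable_lyapunov hθ₀ γ β₁ β₂ k 0
  | succ t ih =>
    refine Measurable.mono ?_ (ℱ.mono (Nat.le_succ t)) le_rfl
    exact ((ih.const_mul r).add
      ((hp.measurable_driftExcess hθ₀ γ β₁ β₂ k a t).const_mul 2)).add measurable_const

variable [IsProbabilityMeasure P]

/-- Induction on time: subtracting the budget turns the contraction into a power `1 - q / 8` of the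
previous moment. -/
theorem IsTrackingProblem.lintegral_exp_lyapunov_sub_budget_le_one
    (hp : IsTrackingProblem P ℱ X law g θs) (hθ₀ : Measurable[ℱ 0] θ₀) (hd : 0 < d)
    {γ β₁ β₂ k q σ l : ℝ} (hk : 0 < k) (hq0 : 0 ≤ q) (hq1 : q ≤ 8) (hσ : 0 < σ) (hl : 0 ≤ l)
    (h1 : 128 * σ ^ 2 * l * (γ / k) ^ 2 ≤ q) (h2 : 4 * d * l * (γ / k) ^ 2 * σ ^ 2 ≤ 1)
    (hs : ∀ t, CondSubGaussian (ℱ t) P (fun ω => noise g (law (t + 1) ω) (X (t + 1) ω)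
      (psi g γ β₁ β₂ (θ₀ ω) (fun n => X n ω) t)) σ) (T : ℕ) :
    ∫⁻ ω, ENNReal.ofReal (Real.exp (l * (lyapunov k (trackingError g γ β₁ β₂ θs θ₀ X ω) T
      - budget (1 - q / 8) (2 * d * (γ / k) ^ 2 * σ ^ 2)
          (lyapunov k (trackingError g γ β₁ β₂ θs θ₀ X ω) 0)
          (driftExcess g γ β₁ β₂ k (1 - q / 4) law θs θ₀ X ω) T))) ∂P ≤ 1 := by
  induction T with
  | zero => simp [budget]
  | succ T ih =>
    have hψ := hp.measurable_psi hθ₀ γ β₁ β₂ T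
    have hζ := (hp.condLaw T).measurable_noise hp.measurable_loss hp.differentiable_loss hψ
    have hY : Measurable (X (T + 1)) := (hp.adapted (T + 1)).mono (ℱ.le _) le_rfl
    have hsub := (hp.condLaw T).ae_subGaussianUnder (ℱ.le T) hY hζ (hs T)
    have hint := ae_noise_integrable_and_integral_eq_zero (hp.condLaw T).isProbabilityMeasure
      (hp.integrable_grad T) (fun ω => psi g γ β₁ β₂ (θ₀ ω) (fun n => X n ω) T)
    obtain ⟨hS₁, hS₂⟩ := hp.measurable_next hθ₀ γ β₁ β₂ k T
    -- The budget at `T + 1` involves the excess only up to `T`, so it is constant under the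
    -- conditional law of the next sample.
    have hB : Measurable[ℱ T] fun ω => budget (1 - q / 8) (2 * d * (γ / k) ^ 2 * σ ^ 2)
        (lyapunov k (trackingError g γ β₁ β₂ θs θ₀ X ω) 0)
        (driftExcess g γ β₁ β₂ k (1 - q / 4) law θs θ₀ X ω) (T + 1) :=
      (((hp.measurable_budget hθ₀ γ β₁ β₂ k (1 - q / 4) (1 - q / 8) _ T).const_mul _).add
        ((hp.measurable_driftExcess hθ₀ γ β₁ β₂ k (1 - q / 4) T).const_mul 2)).add measurable_const
    have hstep := (hp.condLaw T).lintegral_exp_lyapunov_step (ℱ.le T) hY hd hζ hσ hsub hint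
      hS₁ hS₂ hB (U := fun ω => (1 - q / 8) *
        (lyapunov k (trackingError g γ β₁ β₂ θs θ₀ X ω) T
        - budget (1 - q / 8) (2 * d * (γ / k) ^ 2 * σ ^ 2)
          (lyapunov k (trackingError g γ β₁ β₂ θs θ₀ X ω) 0)
          (driftExcess g γ β₁ β₂ k (1 - q / 4) law θs θ₀ X ω) T)) hl h1 h2 fun ω => by
      have hV := lyapunov_nonneg k (trackingError g γ β₁ β₂ θs θ₀ X ω) T
      have hD0 : 0 ≤ driftExcess g γ β₁ β₂ k (1 - q / 4) law θs θ₀ X ω T := le_max_left _ _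
      have hD1 : meanLyapunov g γ β₁ β₂ k law θs θ₀ X ω T - (1 - q / 4)
          * lyapunov k (trackingError g γ β₁ β₂ θs θ₀ X ω) T
          ≤ driftExcess g γ β₁ β₂ k (1 - q / 4) law θs θ₀ X ω T := le_max_right _ _
      rw [budget]
      change (1 + q / 8) * meanLyapunov g γ β₁ β₂ k law θs θ₀ X ω T + _ - _ ≤ _
      set V := lyapunov k (trackingError g γ β₁ β₂ θs θ₀ X ω) T
      set D := driftExcess g γ β₁ β₂ k (1 - q / 4) law θs θ₀ X ω T
      -- The noise factor is absorbed by `(1 + q / 8) (1 - q / 4) ≤ 1 - q / 8`, and `1 + q / 8 ≤ 2`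
      -- explains the `2 D` in the budget.
      have h3 := mul_le_mul_of_nonneg_left hD1 (by linarith : 0 ≤ 1 + q / 8)
      have h4 := mul_nonneg (sq_nonneg q) hV
      have h5 := mul_le_mul_of_nonneg_right hq1 hD0
      nlinarith
    have hpow := lintegral_rpow_le_rpow_lintegral P
      (F := fun ω => ENNReal.ofReal (Real.exp (l * (lyapunov k
        (trackingError g γ β₁ β₂ θs θ₀ X ω) T
        - budget (1 - q / 8) (2 * d * (γ / k) ^ 2 * σ ^ 2)
          (lyapunov k (trackingError g γ β₁ β₂ θs θ₀ X ω) 0)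
          (driftExcess g γ β₁ β₂ k (1 - q / 4) law θs θ₀ X ω) T))))
      (by
        have hV := (hp.measurable_lyapunov hθ₀ γ β₁ β₂ k T).mono (ℱ.le T) le_rfl
        have hBT := (hp.measurable_budget hθ₀ γ β₁ β₂ k (1 - q / 4) (1 - q / 8)
          (2 * d * (γ / k) ^ 2 * σ ^ 2) T).mono (ℱ.le T) le_rfl
        exact (ENNReal.measurable_ofReal.comp (Real.measurable_exp.comp
          ((hV.sub hBT).const_mul l))).aemeasurable)
      (by linarith : 0 ≤ 1 - q / 8) (by linarith)
    calc _ = _ := lintegral_congr fun ω => by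
          rw [lyapunov_succ hk (trackingError g γ β₁ β₂ θs θ₀ X ω) T
            (meanError g γ β₁ β₂ law θs θ₀ X T ω)
            (noise g (law (T + 1) ω) (X (T + 1) ω) (psi g γ β₁ β₂ (θ₀ ω) (fun n => X n ω) T)) γ
            (by
              rw [trackingError, theta_succ_eq_meanStep_sub g γ β₁ β₂ (θ₀ ω) _ (law (T + 1) ω),
                meanError]
              abel)]
      _ ≤ _ := hstep
      _ = _ := lintegral_congr fun ω => by
          rw [ENNReal.ofReal_rpow_of_pos (Real.exp_pos _), ← Real.exp_mul,
            mul_left_comm, mul_comm (1 - q / 8)]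
      _ ≤ _ := hpow
      _ ≤ 1 := ENNReal.rpow_le_one ih (by linarith)

end Supermartingale

end SGDM

/-! ### The high probability bound -/

namespace SGDM

theorem measure_lt_of_lintegral_exp_le_one {Ω : Type*} [MeasurableSpace Ω] {P : Measure Ω}
    {f : Ω → ℝ} (hf : Measurable f) {l δ : ℝ} (hl : 0 < l) (hδ : 0 < δ)
    (h : ∫⁻ ω, ENNReal.ofReal (Real.exp (l * f ω)) ∂P ≤ 1) :
    P {ω | 1 / l * Real.log (1 / δ) ≤ f ω} ≤ ENNReal.ofReal δ := by
  have hm := mul_meas_ge_le_lintegral (μ := P)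
    (by fun_prop : Measurable fun ω => ENNReal.ofReal (Real.exp (l * f ω)))
    (ENNReal.ofReal (1 / δ))
  have hsub : {ω | 1 / l * Real.log (1 / δ) ≤ f ω}
      ⊆ {ω | ENNReal.ofReal (1 / δ) ≤ ENNReal.ofReal (Real.exp (l * f ω))} := by
    intro ω hω
    have hω : 1 / l * Real.log (1 / δ) ≤ f ω := hω
    refine ENNReal.ofReal_le_ofReal ?_
    rw [← Real.exp_log (by positivity : 0 < 1 / δ)]
    refine Real.exp_le_exp.2 ?_
    have := mul_le_mul_of_nonneg_left hω hl.le
    rwa [← mul_assoc, mul_one_div_cancel hl.ne', one_mul] at this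
  have h1 : ENNReal.ofReal (1 / δ) * P {ω | 1 / l * Real.log (1 / δ) ≤ f ω} ≤ 1 :=
    (mul_le_mul_right (measure_mono hsub) _).trans (hm.trans h)
  calc P {ω | 1 / l * Real.log (1 / δ) ≤ f ω}
      = ENNReal.ofReal δ * (ENNReal.ofReal (1 / δ) * P {ω | 1 / l * Real.log (1 / δ) ≤ f ω}) := by
        rw [← mul_assoc, ← ENNReal.ofReal_mul hδ.le, mul_one_div_cancel hδ.ne',
          ENNReal.ofReal_one, one_mul]
    _ ≤ ENNReal.ofReal δ * 1 := by gcongr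
    _ = ENNReal.ofReal δ := mul_one _

theorem discount_nonneg {γ μ β : ℝ} (hγ : 0 < γ) (hμ : 0 < μ) (hβ : β < 1)
    (h : γ * μ ≤ 2 * (1 - β)) : 0 ≤ discount γ μ β := by
  rw [discount, sub_nonneg, div_le_one (by have : 0 < 1 - β := by linarith
                                           positivity)]
  have : 0 < γ * μ := by positivity
  nlinarith

theorem driftSum_nonneg {d : ℕ} {ρ : ℝ} (hρ : 0 ≤ ρ) (b : ℕ → Vec d) (T : ℕ) :
    0 ≤ driftSum ρ b T :=
  Finset.sum_nonneg fun _ _ => mul_nonneg (pow_nonneg hρ _) (sq_nonneg _)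

theorem driftSum_eq_zero (ρ : ℝ) (b : ℕ → Vec 0) (T : ℕ) : driftSum ρ b T = 0 :=
  Finset.sum_eq_zero fun l _ => by rw [Subsingleton.elim (b l) 0]; simp

theorem driftSum₂_nonneg {d : ℕ} (ρ : ℝ) (b : ℕ → Vec d) (T : ℕ) : 0 ≤ driftSum₂ ρ b T :=
  Finset.sum_nonneg fun _ _ => mul_nonneg (by rw [pow_mul]; positivity) (sq_nonneg _)

theorem trackingBound_nonneg {d T : ℕ} {γ β μ σ δ e₀ D D₂ : ℝ} (hγ : 0 < γ) (hμ : 0 < μ)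
    (hβ : β < 1) (hT : 1 ≤ T) (hδ : 0 < δ) (hδ1 : δ < 1) (hD : 0 ≤ D) (hD₂ : 0 ≤ D₂) :
    0 ≤ trackingBound d T γ β μ σ δ e₀ D D₂ := by
  have hk : 0 < 1 - β := by linarith
  have hT' : (1 : ℝ) ≤ T := by exact_mod_cast hT
  have hlog : 0 ≤ Real.log (2 * T / δ) := by
    refine Real.log_nonneg ?_
    rw [le_div_iff₀ hδ]; linarith
  unfold trackingBound
  positivity

/-- The deterministic comparison of the recursive budget with the tracking bound. -/
theorem budget_le_trackingBound {d T : ℕ} {γ β μ σ δ e₀ D D₂ e V B : ℝ} (hγ : 0 < γ) (hμ : 0 < μ)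
    (hσ : 0 < σ) (hβ0 : 0 ≤ β) (hβ : β < 1) (hT : 1 ≤ T) (hδ : 0 < δ) (hδ1 : δ < 1) (hD : 0 ≤ D)
    (hD₂ : 0 ≤ D₂) (hq : 4 * (γ * μ) ≤ (1 - β) ^ 2) (he : e ≤ 2 * V)
    (hV : V ≤ B + (128 * σ ^ 2 * (γ / (1 - β)) ^ 2 / (γ * μ / (1 - β))
      + 4 * d * (γ / (1 - β)) ^ 2 * σ ^ 2) * Real.log (1 / δ))
    (hB : B ≤ discount γ μ β ^ T * e₀ ^ 2
      + 2 * d * (γ / (1 - β)) ^ 2 * σ ^ 2 / (γ * μ / (1 - β) / 8)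
      + 2 * (9 / (γ * μ * (1 - β)) * D)) :
    e ≤ 64 * trackingBound d T γ β μ σ δ e₀ D D₂ := by
  set k := 1 - β with hkdef
  have hk : 0 < k := by rw [hkdef]; linarith
  have hk1 : k ≤ 1 := by rw [hkdef]; linarith
  have hT' : (1 : ℝ) ≤ T := by exact_mod_cast hT
  have hlog0 : 0 ≤ Real.log (1 / δ) := Real.log_nonneg (by rw [le_div_iff₀ hδ]; linarith)
  have hlog : Real.log (1 / δ) ≤ Real.log (2 * T / δ) := by
    refine Real.log_le_log (by positivity) ?_
    gcongr; linarith
  set Λ := Real.log (2 * T / δ)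
  have hΛ : 0 ≤ Λ := hlog0.trans hlog
  -- This uses `4 γ μ ≤ k² ≤ k`.
  have hγk : γ / k ≤ 1 / (4 * μ) := by
    rw [div_le_div_iff₀ hk (by positivity)]; nlinarith
  have hx : σ ^ 2 * (γ / k) ^ 2 / (γ * μ / k) ≤ σ ^ 2 / μ ^ 2 / 4 := by
    calc σ ^ 2 * (γ / k) ^ 2 / (γ * μ / k) = σ ^ 2 / μ * (γ / k) := by field_simp
      _ ≤ σ ^ 2 / μ * (1 / (4 * μ)) := by gcongr
      _ = σ ^ 2 / μ ^ 2 / 4 := by field_simp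
  have hρ0 : 0 ≤ discount γ μ β := discount_nonneg hγ hμ hβ (by nlinarith)
  have hρ : discount γ μ β ^ T ≤ 2 / k ^ 2 * Real.exp (-(γ ^ 2 * μ ^ 2 / (4 * k ^ 2)) * T) := by
    have h1 : discount γ μ β ≤ Real.exp (-(γ ^ 2 * μ ^ 2 / (4 * k ^ 2))) := by
      have := Real.add_one_le_exp (-(γ ^ 2 * μ ^ 2 / (4 * k ^ 2)))
      rw [discount, ← hkdef]; linarith
    have h2 := pow_le_pow_left₀ hρ0 h1 T
    rw [← Real.exp_nat_mul, mul_comm (T : ℝ)] at h2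
    refine h2.trans (le_mul_of_one_le_left (Real.exp_pos _).le ?_)
    rw [le_div_iff₀ (by positivity)]; nlinarith
  have t1 := mul_le_mul_of_nonneg_right hρ (sq_nonneg e₀)
  have t2 : 2 * d * (γ / k) ^ 2 * σ ^ 2 / (γ * μ / k / 8) ≤ 4 * (d * σ ^ 2 / μ ^ 2) := by
    calc 2 * d * (γ / k) ^ 2 * σ ^ 2 / (γ * μ / k / 8)
        = 16 * d * (σ ^ 2 * (γ / k) ^ 2 / (γ * μ / k)) := by field_simp; ring
      _ ≤ 16 * d * (σ ^ 2 / μ ^ 2 / 4) := by gcongr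
      _ = _ := by ring
  have t3 : 2 * (9 / (γ * μ * k) * D) = 18 * (1 / (γ * μ) * (1 / k) * D) := by
    field_simp; norm_num [mul_comm]
  have t4 : (128 * σ ^ 2 * (γ / k) ^ 2 / (γ * μ / k) + 4 * d * (γ / k) ^ 2 * σ ^ 2)
      * Real.log (1 / δ) ≤ 32 * (σ ^ 2 / μ ^ 2) * Λ + 4 * (d * σ ^ 2 * γ ^ 2 / k ^ 2) * Λ := by
    rw [← add_mul]
    refine mul_le_mul ?_ hlog hlog0 (by positivity)
    have e1 : 128 * σ ^ 2 * (γ / k) ^ 2 / (γ * μ / k)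
        = 128 * (σ ^ 2 * (γ / k) ^ 2 / (γ * μ / k)) := by ring
    have e2 : 4 * d * (γ / k) ^ 2 * σ ^ 2 = 4 * (d * σ ^ 2 * γ ^ 2 / k ^ 2) := by
      rw [div_pow]; ring
    linarith
  have p1 : 0 ≤ 2 / k ^ 2 * Real.exp (-(γ ^ 2 * μ ^ 2 / (4 * k ^ 2)) * T) * e₀ ^ 2 := by positivity
  have p2 : 0 ≤ d * σ ^ 2 / μ ^ 2 := by positivity
  have p3 : 0 ≤ 1 / (γ * μ) * (1 / k) * D := by positivity
  have p4 : 0 ≤ d * σ ^ 2 * γ ^ 2 / k ^ 2 * Λ := by positivity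
  have p5 : 0 ≤ (d : ℝ) ^ 2 * σ ^ 4 * γ ^ 3 / (μ * k ^ 3) * Λ := by positivity
  have p6 : 0 ≤ σ ^ 2 / μ ^ 2 * Λ := by positivity
  have p7 : 0 ≤ σ ^ 2 * γ ^ 2 / k ^ 2 * D₂ * Λ := by positivity
  unfold trackingBound
  rw [← hkdef]
  -- The constant `64 = 2 * 32` comes from `e ≤ 2 V` and the coefficient `128 / 4` of `σ² / μ²`
  -- times the logarithm; `p5` and `p7` only add slack.
  linarith

/-! ### Almost sure consequences of the curvature assumptions -/

section Almost

variable {d : ℕ} {Ω 𝒳 : Type*} [MeasurableSpace 𝒳] [mΩ : MeasurableSpace Ω] {P : Measure Ω}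
  {ℱ : Filtration ℕ mΩ} {X : ℕ → Ω → 𝒳} {law : ℕ → Ω → Measure 𝒳} {g : Vec d → 𝒳 → ℝ}
  {θs : ℕ → Ω → Vec d} {θ₀ : Ω → Vec d}

/-- Strong monotonicity and Lipschitz continuity force `μ ≤ L` in positive dimension. -/
theorem UniformlyStronglyMonotone.le_of_uniformlyLipschitz [IsProbabilityMeasure P] {μ L : ℝ}
    (hm : UniformlyStronglyMonotone P law g μ) (hL : UniformlyLipschitz P law g L) (hd : 0 < d) :
    μ ≤ L := by
  obtain ⟨ω, h1, h2⟩ := ((hm 0).and (hL 0)).exists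
  set u : Vec d := EuclideanSpace.single ⟨0, hd⟩ 1
  have hu : ‖u‖ = 1 := by simp [u]
  have h1 := h1 u 0
  have h2 := h2 u 0
  rw [sub_zero, hu] at h1 h2
  have h3 := real_inner_le_norm (meanGrad g (law (0 + 1) ω) u - meanGrad g (law (0 + 1) ω) 0) u
  rw [hu] at h3
  linarith

/-- Almost surely, the drift excess is controlled by the forcing term. -/
theorem IsTrackingProblem.ae_driftExcess_le (hp : IsTrackingProblem P ℱ X law g θs) {μ L : ℝ}
    (hμ : 0 < μ) (hL0 : 0 < L) (hm : UniformlyStronglyMonotone P law g μ)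
    (hL : UniformlyLipschitz P law g L) {γ β₁ β₂ k : ℝ} (hk : 0 < k) (hβ : β₁ + β₂ = 1 - k)
    (hβ₁ : 0 ≤ β₁) (hβ₂ : 0 ≤ β₂) (h : β₁ * β₂ = 0) (hγ : 0 < γ)
    (hγL : 4 * (γ * L ^ 2) ≤ μ * k ^ 2) (hq : 4 * (γ * μ) ≤ k ^ 2) :
    ∀ᵐ ω ∂P, ∀ t, driftExcess g γ β₁ β₂ k (1 - γ * μ / k / 4) law θs θ₀ X ω t
      ≤ 9 / (γ * μ * k) * ‖randomForcing g γ β₁ β₂ law θs θ₀ X ω t‖ ^ 2 := by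
  rw [ae_all_iff]
  intro t
  filter_upwards [hm t, hL t, hp.hasGradientAt_risk t, hp.twice_differentiable_risk t,
    hp.isMinOn_star t] with ω hmω hLω hgω hdω hminω
  -- The Hessian of the risk is the derivative of the mean gradient, which carries the monotonicity
  -- and Lipschitz bounds.
  have hgrad : gradient (risk g (law (t + 1) ω)) = meanGrad g (law (t + 1) ω) :=
    funext fun θ => (hgω θ).gradient
  have hstar : meanGrad g (law (t + 1) ω) (θs (t + 1) ω) = 0 := by
    have hz := (hminω.isLocalMin Filter.univ_mem).hasFDerivAt_eq_zero (hgω _).hasFDerivAt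
    simpa using hz
  rw [hgrad] at hdω
  set ψ := psi g γ β₁ β₂ (θ₀ ω) (fun n => X n ω) t with hψ
  have hH : avgHessian g (law (t + 1) ω) (θs (t + 1) ω) ψ
      = ∫ s in (0 : ℝ)..1, fderiv ℝ (meanGrad g (law (t + 1) ω))
          (θs (t + 1) ω + s • (ψ - θs (t + 1) ω)) := by
    rw [avgHessian, hgrad]
  refine max_le (by positivity) ?_
  rw [sub_le_iff_le_add']
  refine mean_lyapunov_le (θs := fun n => θs n ω)
    (H := fun n => avgHessian g (law (n + 1) ω) (θs (n + 1) ω)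
      (psi g γ β₁ β₂ (θ₀ ω) (fun k => X k ω) n)) hμ ?_ ?_ ?_ hk hβ hβ₁ hβ₂ h hγ hγL hq
  · intro v
    change ‖avgHessian g (law (t + 1) ω) (θs (t + 1) ω) ψ v‖ ≤ _
    rw [hH]
    exact norm_average_fderiv_apply_le hL0.le hLω _ _ v
  · intro v
    change _ ≤ inner ℝ (avgHessian g (law (t + 1) ω) (θs (t + 1) ω) ψ v) v
    rw [hH]
    exact le_inner_average_fderiv hdω hL0.le hLω hmω _ _ v
  · change avgHessian g (law (t + 1) ω) (θs (t + 1) ω) ψ (ψ - θs (t + 1) ω) = _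
    rw [hH, average_fderiv_apply_sub hdω hL0.le hLω, hstar, sub_zero]

end Almost

end SGDM

theorem mainTheorem6 :
    ∃ C : ℝ, 0 < C ∧
      ∀ (d : ℕ) (Ω : Type u) [mΩ : MeasurableSpace Ω] (P : Measure Ω) [IsProbabilityMeasure P]
        (𝒳 : Type v) [MeasurableSpace 𝒳]
        (ℱ : Filtration ℕ mΩ) (X : ℕ → Ω → 𝒳) (law : ℕ → Ω → Measure 𝒳)
        (g : SGDM.Vec d → 𝒳 → ℝ) (θs : ℕ → Ω → SGDM.Vec d) (θ₀ : Ω → SGDM.Vec d)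
        (μ L σ γ β β₁ β₂ : ℝ),
        SGDM.IsTrackingProblem P ℱ X law g θs →
        0 < μ → SGDM.UniformlyStronglyMonotone P law g μ →
        0 < L → SGDM.UniformlyLipschitz P law g L →
        0 ≤ β → β < 1 → 0 ≤ β₁ → 0 ≤ β₂ → β₁ + β₂ = β → β₁ * β₂ = 0 →
        0 < γ → γ ≤ min (1 / L) (μ * (1 - β) ^ 2 / (4 * L ^ 2)) →
        Measurable[ℱ 0] θ₀ →
        0 < σ →
        (∀ t, SGDM.CondSubGaussian (ℱ t) P
          (fun ω => SGDM.noise g (law (t + 1) ω) (X (t + 1) ω)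
            (SGDM.psi g γ β₁ β₂ (θ₀ ω) (fun n => X n ω) t)) σ) →
        ∀ T : ℕ, 1 ≤ T → ∀ δ : ℝ, 0 < δ → δ < 1 →
          -- the exceptional set has outer measure at most `δ`
          P {ω | ¬ (‖SGDM.theta g γ β₁ β₂ (θ₀ ω) (fun n => X n ω) T - θs T ω‖ ^ 2 ≤
              C * SGDM.trackingBound d T γ β μ σ δ ‖θ₀ ω - θs 0 ω‖
                (SGDM.driftSum (SGDM.discount γ μ β)
                  (SGDM.randomForcing g γ β₁ β₂ law θs θ₀ X ω) T)
                (SGDM.driftSum₂ (SGDM.discount γ μ β)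
                  (SGDM.randomForcing g γ β₁ β₂ law θs θ₀ X ω) T))}
            ≤ ENNReal.ofReal δ := by
  refine ⟨64, by norm_num, ?_⟩
  intro d Ω mΩ P _ 𝒳 _ ℱ X law g θs θ₀ μ L σ γ β β₁ β₂ hp hμ hm hL0 hL hβ0 hβ1 hβ₁ hβ₂ hβ h hγ hγle
    hθ₀ hσ hs T hT δ hδ hδ1
  have hk : 0 < 1 - β := by linarith
  rcases Nat.eq_zero_or_pos d with rfl | hd
  -- In dimension `0` the inequality `μ ≤ L` is not available, but the error and the drift sum
  -- vanish.
  · refine le_of_eq_of_le (?_ : _ = (0 : ENNReal)) zero_le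
    convert measure_empty (μ := P)
    refine Set.eq_empty_iff_forall_notMem.2 fun ω hω => hω ?_
    have hD := SGDM.driftSum_eq_zero (SGDM.discount γ μ β)
      (SGDM.randomForcing g γ β₁ β₂ law θs θ₀ X ω) T
    rw [Subsingleton.elim (SGDM.theta g γ β₁ β₂ (θ₀ ω) (fun n => X n ω) T - θs T ω) 0, norm_zero]
    have := SGDM.trackingBound_nonneg (d := 0) (σ := σ) (e₀ := ‖θ₀ ω - θs 0 ω‖) hγ hμ hβ1 hT hδ hδ1
      hD.ge (SGDM.driftSum₂_nonneg (SGDM.discount γ μ β)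
        (SGDM.randomForcing g γ β₁ β₂ law θs θ₀ X ω) T)
    simpa using this
  have hμL := hm.le_of_uniformlyLipschitz hL hd
  have hγL : 4 * (γ * L ^ 2) ≤ μ * (1 - β) ^ 2 := by
    have := hγle.trans (min_le_right _ _)
    rw [le_div_iff₀ (by positivity)] at this
    linarith
  have hq : 4 * (γ * μ) ≤ (1 - β) ^ 2 := by
    have h1 : γ * μ ^ 2 ≤ γ * L ^ 2 := by gcongr
    have h2 : μ * (4 * (γ * μ)) ≤ μ * (1 - β) ^ 2 := by nlinarith
    exact le_of_mul_le_mul_left h2 hμ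
  set q := γ * μ / (1 - β) with hqdef
  have hq0 : 0 < q := by positivity
  have hq1 : q ≤ 1 / 4 := by
    rw [hqdef, div_le_iff₀ hk]; nlinarith
  -- `M` is the sum of the reciprocals of the largest `l` allowed by each of the two constraints, so
  -- `l = 1 / M` meets both.
  set M := 128 * σ ^ 2 * (γ / (1 - β)) ^ 2 / q + 4 * d * (γ / (1 - β)) ^ 2 * σ ^ 2 with hM
  have hd' : (0 : ℝ) < d := by exact_mod_cast hd
  have hM1 : 0 < 128 * σ ^ 2 * (γ / (1 - β)) ^ 2 / q := by positivity
  have hM2 : 0 < 4 * d * (γ / (1 - β)) ^ 2 * σ ^ 2 := by positivity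
  have hM0 : 0 < M := by positivity
  have hl1 : 128 * σ ^ 2 * (1 / M) * (γ / (1 - β)) ^ 2 ≤ q := by
    have h1 : 128 * σ ^ 2 * (γ / (1 - β)) ^ 2 / q ≤ M := by linarith
    rw [div_le_iff₀ hq0] at h1
    rw [show 128 * σ ^ 2 * (1 / M) * (γ / (1 - β)) ^ 2
      = 128 * σ ^ 2 * (γ / (1 - β)) ^ 2 / M by ring, div_le_iff₀ hM0]
    linarith
  have hl2 : 4 * d * (1 / M) * (γ / (1 - β)) ^ 2 * σ ^ 2 ≤ 1 := by
    rw [show 4 * d * (1 / M) * (γ / (1 - β)) ^ 2 * σ ^ 2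
      = 4 * d * (γ / (1 - β)) ^ 2 * σ ^ 2 / M by ring, div_le_one hM0]
    linarith
  have hexp := hp.lintegral_exp_lyapunov_sub_budget_le_one hθ₀ hd hk hq0.le (by linarith) hσ
    (by positivity : 0 ≤ 1 / M) hl1 hl2 hs T
  have hae := hp.ae_driftExcess_le (θ₀ := θ₀) hμ hL0 hm hL hk (by linarith) hβ₁ hβ₂ h hγ hγL hq
  have hmeas := ((hp.measurable_lyapunov hθ₀ γ β₁ β₂ (1 - β) T).mono (ℱ.le T) le_rfl).sub
    ((hp.measurable_budget hθ₀ γ β₁ β₂ (1 - β) (1 - q / 4) (1 - q / 8)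
      (2 * d * (γ / (1 - β)) ^ 2 * σ ^ 2) T).mono (ℱ.le T) le_rfl)
  have hmarkov := SGDM.measure_lt_of_lintegral_exp_le_one hmeas (by positivity : 0 < 1 / M) hδ hexp
  -- The bad set need not be measurable; up to a null set it lies in the measurable event of the
  -- Markov bound.
  refine le_trans (measure_mono_ae ?_) hmarkov
  filter_upwards [hae] with ω hω hbad
  by_contra hgood
  refine hbad ?_
  change ¬ (1 / (1 / M) * Real.log (1 / δ) ≤ _ - _) at hgood
  rw [one_div_one_div, not_le, sub_lt_iff_lt_add'] at hgood
  have hρ0 := SGDM.discount_nonneg hγ hμ hβ1 (by nlinarith)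
  -- The discount equals `1 - q² / 4`, and `q ≤ 1 / 2` suffices for the comparison.
  have hρ : 1 - q / 8 ≤ SGDM.discount γ μ β := by
    have : SGDM.discount γ μ β = 1 - q ^ 2 / 4 := by
      rw [SGDM.discount, hqdef]; field_simp
    rw [this]; nlinarith
  have hB := SGDM.budget_le (r := 1 - q / 8) (c := 2 * d * (γ / (1 - β)) ^ 2 * σ ^ 2)
    (v := SGDM.lyapunov (1 - β) (SGDM.trackingError g γ β₁ β₂ θs θ₀ X ω) 0)
    (by linarith) (by linarith) hρ (by positivity) (SGDM.lyapunov_nonneg _ _ _)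
    (fun t => by positivity) hω T
  refine SGDM.budget_le_trackingBound hγ hμ hσ hβ0 hβ1 hT hδ hδ1 (SGDM.driftSum_nonneg hρ0 _ _)
    (SGDM.driftSum₂_nonneg _ _ _) hq
    (SGDM.norm_sq_le_lyapunov hk (by linarith) (SGDM.trackingError g γ β₁ β₂ θs θ₀ X ω) T)
    hgood.le (hB.trans (le_of_eq ?_))
  rw [SGDM.lyapunov_zero, sub_sub_cancel]
  congr 2
  rw [SGDM.driftSum, Finset.mul_sum]
  exact Finset.sum_congr rfl fun l _ => by ring
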